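/- Let $S$ be a locally compact, separable metric space, $\nu_0$ a diffuse Borel probability measure on $S$ (that is, $\nu_0(\{x\})=0$ for all $x\in S$), $\alpha=\tfrac12$ and $\theta>-\tfrac12$. Let $U_1,U_2,\dots$ be independent with $U_k\sim\mathrm{Beta}(1-\alpha,\theta+k\alpha)$, put $V_n=(1-U_1)\cdots(1-U_{n-1})U_n$, let $P_1\ge P_2\ge\cdots$ be the sequence $(V_n)$ in descending order, let $\xi_1,\xi_2,\dots$ be i.i.d. with law $\nu_0$, independent of $(U_k)$, and let $\Pi$ be the law of $\sum_{k\ge1}P_k\delta_{\xi_k}$ on the space $\mathcal P_1(S)$ of Borel probability measures on $S$ (the two-parameter Dirichlet process). Let $\mathcal F$ be the set of functions $F(\mu)=f(\langle\phi_1,\mu\rangle,\dots,\langle\phi_d,\mu\rangle)$ on $\mathcal P_1(S)$ with $d\ge1$, $f\in C^\infty(\mathbb R^d)$ and $\phi_1,\dots,\phi_d$ bounded Borel functions on $S$. For such $F$ put $\nabla_xF(\mu)=\sum_{i}\partial_if(\langle\phi_1,\mu\rangle,\dots,\langle\phi_d,\mu\rangle)\phi_i(x)$, and for $F,G\in\mathcal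 F$ $$\mathcal E(F,G)=\frac12\int_{\mathcal P_1(S)}\langle\nabla F(\mu),\nabla G(\mu)\rangle_\mu\,\Pi(d\mu),\qquad \langle\phi,\psi\rangle_\mu=\int\phi\psi\,d\mu-\int\phi\,d\mu\int\psi\,d\mu .$$ Let $(B^k_1,\dots,B^k_{2^k})_{k\ge1}$ be Borel partitions of $S$ with $\nu_0(B^k_j)=2^{-k}$ and $B^k_j=B^{k+1}_{2j-1}\cup B^{k+1}_{2j}$ for all $k\ge1$, $1\le j\le2^k$, and suppose that the sets $B^k_j$ together generate the Borel $\sigma$-algebra of $S$ up to $\nu_0$-null sets. Put $$\mathcal F_k=\{F(\mu)=f(\mu(B^k_1),\dots,\mu(B^k_{2^k-1})): f\in C^\infty(\mathbb R^{2^k-1})\}.$$ Then every form $(\mathcal E,\mathcal F_k)$ is closable on $L^2(\Pi):=L^2(\mathcal P_1(S);\Pi)$, with closure denoted $(\mathcal E,D(\mathcal E)_k)$; the form $(\mathcal E,\mathcal F)$ has a relaxation $(\Xi,D(\Xi))$, i.e. there is a greatest lower semicontinuous nonnegative symmetric bilinear form on $L^2(\Pi)$ which is a minorant of $(\mathcal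 E,\mathcal F)$; and the forms $(\mathcal E,\mathcal F_k)$, through their closures, converge to $(\Xi,D(\Xi))$ in the sense of Mosco as $k\to\infty$. That is, with the convention that a form takes the value $+\infty$ on the diagonal outside its domain: (a) if $F_k\to F$ weakly in $L^2(\Pi)$, then $\liminf_{k\to\infty}\mathcal E(F_k,F_k)\ge\Xi(F,F)$, where $\mathcal E(F_k,F_k)$ is the value of the form $(\mathcal E,D(\mathcal E)_k)$; (b) for every $F\in L^2(\Pi)$ there are $F_k\to F$ strongly in $L^2(\Pi)$ with $\limsup_{k\to\infty}\mathcal E(F_k,F_k)\le\Xi(F,F)$, with the same meaning of $\mathcal E(F_k,F_k)$. -/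

import Mathlib

open MeasureTheory ProbabilityTheory Filter Topology
open scoped ENNReal ContDiff

namespace TwoParamDirichlet

noncomputable section

/-! ### The two-parameter Dirichlet process -/

/-- Stick breaking: `V₀ = U₀`, `Vₙ = (1 - U₀) ⋯ (1 - Uₙ₋₁) Uₙ`. -/
def stick (U : ℕ → ℝ) (n : ℕ) : ℝ := (∏ i ∈ Finset.range n, (1 - U i)) * U n

/-- The descending rearrangement of a sequence of weights: `ranked v k` is the `(k+1)`-st largest
value of `v`, counted with multiplicity. -/
def ranked (v : ℕ → ℝ) (k : ℕ) : ℝ :=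
  sInf {t : ℝ | 0 ≤ t ∧ {i | t < v i}.encard ≤ k}

/-- The law of independent `U₀, U₁, …` with `Uₖ ∼ Beta(1 - α, θ + (k + 1) α)`. -/
def stickLaw (α θ : ℝ) : Measure (ℕ → ℝ) :=
  Measure.infinitePi fun k : ℕ => betaMeasure (1 - α) (θ + (k + 1) * α)

variable {S : Type*} [MeasurableSpace S]

/-- The measure `∑ₖ Pₖ δ_{ξₖ}`, where `P` is the stick-breaking sequence of `U` in descending
order. -/
def atomicMeasure (U : ℕ → ℝ) (ξ : ℕ → S) : Measure S :=
  Measure.sum fun k => ENNReal.ofReal (ranked (stick U) k) • Measure.dirac (ξ k)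

open Classical in
/-- `∑ₖ Pₖ δ_{ξₖ}` as a point of the space of probability measures. The value `ν₀` is only used on
the null event that the weights do not sum to one. -/
def randomMeasure (ν₀ : ProbabilityMeasure S) (p : (ℕ → ℝ) × (ℕ → S)) : ProbabilityMeasure S :=
  if h : IsProbabilityMeasure (atomicMeasure p.1 p.2) then ⟨atomicMeasure p.1 p.2, h⟩ else ν₀

/-- The two-parameter Dirichlet process `Π_{α,θ,ν₀}`: the law of `∑ₖ Pₖ δ_{ξₖ}`, where the `ξₖ` are
i.i.d. with law `ν₀` and independent of the weights. -/
def dirichletLaw (α θ : ℝ) (ν₀ : ProbabilityMeasure S) : Measure (ProbabilityMeasure S) :=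
  ((stickLaw α θ).prod (Measure.infinitePi fun _ : ℕ => (ν₀ : Measure S))).map (randomMeasure ν₀)

instance (α θ : ℝ) : IsFiniteMeasure (stickLaw α θ) := by
  unfold stickLaw
  by_cases h : ∀ k : ℕ, IsProbabilityMeasure (betaMeasure (1 - α) (θ + (k + 1) * α))
  · infer_instance
  · rw [Measure.infinitePi, dif_neg h]
    infer_instance

instance (α θ : ℝ) (ν₀ : ProbabilityMeasure S) : IsFiniteMeasure (dirichletLaw α θ ν₀) := by
  unfold dirichletLaw
  infer_instance

/-! ### Cylinder functions and the gradient form -/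

/-- A cylinder function `F(μ) = f(⟨φ₁, μ⟩, …, ⟨φ_d, μ⟩)` with bounded Borel `φᵢ` and smooth `f`. -/
structure Cyl (S : Type*) [MeasurableSpace S] where
  d : ℕ
  φ : Fin d → S → ℝ
  φ_meas : ∀ i, Measurable (φ i)
  φ_bdd : ∀ i, ∃ C, ∀ x, |φ i x| ≤ C
  f : (Fin d → ℝ) → ℝ
  f_smooth : ContDiff ℝ ∞ f

namespace Cyl

/-- The vector `(⟨φ₁, μ⟩, …, ⟨φ_d, μ⟩)`. -/
def pairing (F : Cyl S) (μ : ProbabilityMeasure S) : Fin F.d → ℝ :=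
  fun i => ∫ x, F.φ i x ∂(μ : Measure S)

/-- The value `F(μ)`. -/
def eval (F : Cyl S) (μ : ProbabilityMeasure S) : ℝ := F.f (F.pairing μ)

/-- The gradient `∇ₓF(μ) = ∑ᵢ ∂ᵢf(⟨φ₁, μ⟩, …, ⟨φ_d, μ⟩) φᵢ(x)`, the derivative of
`f(⟨φ₁, μ + sδₓ⟩, …, ⟨φ_d, μ + sδₓ⟩)` at `s = 0`. -/
def grad (F : Cyl S) (μ : ProbabilityMeasure S) (x : S) : ℝ :=
  ∑ i, fderiv ℝ F.f (F.pairing μ) (Pi.single i 1) * F.φ i x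

theorem measurable_eval (F : Cyl S) : Measurable F.eval := by
  refine F.f_smooth.continuous.measurable.comp (measurable_pi_lambda _ fun i => ?_)
  let κ : Kernel (ProbabilityMeasure S) S := ⟨fun μ => (μ : Measure S), measurable_subtype_coe⟩
  exact (StronglyMeasurable.integral_kernel (κ := κ)
    (F.φ_meas i).stronglyMeasurable).measurable

theorem exists_bound (F : Cyl S) : ∃ C, ∀ μ, ‖F.eval μ‖ ≤ C := by
  choose C hC using F.φ_bdd
  obtain ⟨K, hK⟩ := (isCompact_univ_pi fun i =>
    isCompact_Icc (a := -C i) (b := C i)).exists_bound_of_continuousOn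
      F.f_smooth.continuous.continuousOn
  refine ⟨K, fun μ => hK _ fun i _ => ?_⟩
  have h : ‖∫ x, F.φ i x ∂(μ : Measure S)‖ ≤ C i := by
    simpa using norm_integral_le_of_norm_le_const (μ := (μ : Measure S)) (f := F.φ i)
      (Eventually.of_forall fun x => hC i x)
  exact abs_le.mp h

theorem memLp (F : Cyl S) (P : Measure (ProbabilityMeasure S)) [IsFiniteMeasure P] :
    MemLp F.eval 2 P :=
  F.exists_bound.elim fun C hC =>
    MemLp.of_bound F.measurable_eval.aestronglyMeasurable C (Eventually.of_forall hC)

/-- The class of `F` in `L²(𝒫₁(S); P)`. -/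
def toL2 (P : Measure (ProbabilityMeasure S)) [IsFiniteMeasure P] (F : Cyl S) : Lp ℝ 2 P :=
  (F.memLp P).toLp F.eval

end Cyl

/-- `⟨φ, ψ⟩_μ = ∫ φψ dμ - (∫ φ dμ)(∫ ψ dμ)`. -/
def covar (μ : ProbabilityMeasure S) (φ ψ : S → ℝ) : ℝ :=
  (∫ x, φ x * ψ x ∂(μ : Measure S)) - (∫ x, φ x ∂(μ : Measure S)) * ∫ x, ψ x ∂(μ : Measure S)

/-- `ℰ(F, G) = ½ ∫ ⟨∇F(μ), ∇G(μ)⟩_μ P(dμ)`. -/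
def gradForm (P : Measure (ProbabilityMeasure S)) (F G : Cyl S) : ℝ :=
  1 / 2 * ∫ μ, covar μ (F.grad μ) (G.grad μ) ∂P

/-! ### Dyadic partitions and the projected cylinder functions -/

/-- A sequence of successively halved Borel partitions of `S` into `2ᵏ` cells of `ν`-mass `2⁻ᵏ`; the cells of
generation `k` are indexed by `0, …, 2ᵏ - 1`. -/
structure DyadicPartition (ν : Measure S) where
  B : (k : ℕ) → Fin (2 ^ k) → Set S
  meas : ∀ k j, MeasurableSet (B k j)
  disj : ∀ k, Pairwise fun i j => Disjoint (B k i) (B k j)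
  cover : ∀ k, ⋃ j, B k j = Set.univ
  mass : ∀ k j, ν (B k j) = (2 ^ k)⁻¹
  split : ∀ k (j : Fin (2 ^ k)),
    B k j = B (k + 1) ⟨2 * j, by have := j.2; rw [pow_succ]; omega⟩ ∪
      B (k + 1) ⟨2 * j + 1, by have := j.2; rw [pow_succ]; omega⟩

namespace DyadicPartition

variable {ν : Measure S}

/-- The cells generate the Borel σ-algebra up to `ν`-null sets. -/
def Generates (D : DyadicPartition ν) : Prop :=
  ∀ A, MeasurableSet A → ∃ A',
    MeasurableSet[MeasurableSpace.generateFrom {s | ∃ k j, s = D.B k j}] A' ∧ A =ᵐ[ν] A'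

/-- `μ ↦ f(⟨1_{B₁}, μ⟩, …, ⟨1_{B_{2ᵏ-1}}, μ⟩)`, with the cells of generation `k` except the last. -/
def cyl (D : DyadicPartition ν) (k : ℕ) (f : (Fin (2 ^ k - 1) → ℝ) → ℝ) (hf : ContDiff ℝ ∞ f) :
    Cyl S where
  d := 2 ^ k - 1
  φ i := (D.B k ⟨i, by have := i.2; omega⟩).indicator fun _ => 1
  φ_meas i := measurable_const.indicator (D.meas k _)
  φ_bdd i := ⟨1, fun x => by
    by_cases h : x ∈ D.B k ⟨i, by have := i.2; omega⟩ <;> simp [h]⟩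
  f := f
  f_smooth := hf

/-- The class `ℱₖ`. -/
def cylSet (D : DyadicPartition ν) (k : ℕ) : Set (Cyl S) := {F | ∃ f hf, F = D.cyl k f hf}

end DyadicPartition

/-! ### Nonnegative symmetric forms on a real Hilbert space -/

/-- A nonnegative symmetric bilinear form with domain a linear subspace of `H`. -/
structure SymForm (H : Type*) [NormedAddCommGroup H] [InnerProductSpace ℝ H] where
  dom : Submodule ℝ H
  form : dom →ₗ[ℝ] dom →ₗ[ℝ] ℝ
  symm : ∀ u v, form u v = form v u
  nonneg : ∀ u, 0 ≤ form u u

section Forms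

variable {H : Type*} [NormedAddCommGroup H] [InnerProductSpace ℝ H]

open Classical in
/-- The quadratic functional `u ↦ q(u, u)`, extended by `∞` outside the domain. -/
def SymForm.energy (q : SymForm H) (u : H) : ℝ≥0∞ :=
  if h : u ∈ q.dom then ENNReal.ofReal (q.form ⟨u, h⟩ ⟨u, h⟩) else ⊤

/-- A form is closed if its domain is complete for `q(u, u) + ‖u‖²`. -/
def SymForm.Closed (q : SymForm H) : Prop :=
  ∀ u : ℕ → q.dom, CauchySeq (fun n => (u n : H)) →
    (∀ ε > 0, ∃ N, ∀ m ≥ N, ∀ n ≥ N, q.form (u m - u n) (u m - u n) < ε) →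
    ∃ v : q.dom, Tendsto (fun n => (u n : H)) atTop (𝓝 v) ∧
      Tendsto (fun n => q.form (u n - v) (u n - v)) atTop (𝓝 0)

variable {ι : Type*}

/-- `q` is the closure of the form `e` on the functions labelled by `C`, where the function
labelled by `F` has the class `J F` in `H`: `q` is closed, extends `e`, and every element of its
domain is a limit of elements of `C` for `q(u, u) + ‖u‖²`. -/
structure IsClosureOf (q : SymForm H) (J : ι → H) (e : ι → ι → ℝ) (C : Set ι) : Prop where
  closed : q.Closed
  extend : ∀ F ∈ C, ∀ G ∈ C, ∃ (hF : J F ∈ q.dom) (hG : J G ∈ q.dom),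
    q.form ⟨J F, hF⟩ ⟨J G, hG⟩ = e F G
  core : ∀ u ∈ q.dom, ∃ F : ℕ → ι, (∀ n, F n ∈ C) ∧ Tendsto (fun n => J (F n)) atTop (𝓝 u) ∧
    Tendsto (fun n => q.energy (J (F n) - u)) atTop (𝓝 0)

/-- `q` is a lower semicontinuous form on `H` that is a minorant of `e` on `C`. -/
def IsLscMinorant (q : SymForm H) (J : ι → H) (e : ι → ι → ℝ) (C : Set ι) : Prop :=
  LowerSemicontinuous q.energy ∧ ∀ F ∈ C, q.energy (J F) ≤ ENNReal.ofReal (e F F)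

/-- `q` is the relaxation of the form `e` on `C`: its greatest lower semicontinuous minorant among
the forms on `H`. -/
def IsRelaxation (q : SymForm H) (J : ι → H) (e : ι → ι → ℝ) (C : Set ι) : Prop :=
  IsLscMinorant q J e C ∧ ∀ p : SymForm H, IsLscMinorant p J e C → ∀ u, p.energy u ≤ q.energy u

/-- Mosco convergence of forms on `H`. -/
def MoscoTendsto (q : ℕ → SymForm H) (p : SymForm H) : Prop :=
  (∀ (u : ℕ → H) (w : H),
      (∀ v : H, Tendsto (fun k => inner ℝ (u k) v) atTop (𝓝 (inner ℝ w v))) →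
      p.energy w ≤ liminf (fun k => (q k).energy (u k)) atTop) ∧
    ∀ w : H, ∃ u : ℕ → H, Tendsto u atTop (𝓝 w) ∧
      limsup (fun k => (q k).energy (u k)) atTop ≤ p.energy w

end Forms

end

end TwoParamDirichlet

open TwoParamDirichlet

/-! Write `D F` for the centred gradient `∇ₓF(μ) - ⟨∇F(μ), μ⟩` divided by `√2`, an element of `L²`
of the measure `Π(dμ) μ(dx)`. Then `ℰ(F, G) = ⟨D F, D G⟩`, and everything can be read off the graph
of `D` in the product of the two `L²` spaces.

Suppose that `D` is closable on all cylinder functions and that the graphs `Γ k` over `ℱₖ` increase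
to a dense part of the graph over `ℱ`. Then the closure `W` of the union is the graph of an
operator. Its form is closed, hence lower semicontinuous, and it is the relaxation `Ξ`, because a
lower semicontinuous minorant is controlled along any approximating sequence. The closure of `ℰ` on
`ℱₖ` is the restriction of `Ξ` given by the closure of `Γ k`. The lower bound of Mosco convergence
is therefore weak lower semicontinuity of `Ξ`, and recovery sequences come from the orthogonal
projections of a point of `W` onto the closures of the `Γ k`. This is
`exists_closure_relaxation_mosco`; what remains is closability and density.

Closability (`gradL2_closable`). As the `ξᵢ` are i.i.d., the weights may be kept in stick-breaking
order (`dirichletLaw_eq`). Freeze everything but `Uₖ`: the random measure then runs along a segment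
from `μ₀` (`Uₖ = 0`) to `μ₁` (`Uₖ = 1`), and the parameter has a positive continuous density on `(0,
1)`. The derivative along the segment is the `μ₁`-integral of the centred gradient up to the factor
`(1 - u)⁻¹`, so closability on an interval shows that a limit `G` of centred gradients of functions
tending to `0` has `μ₁`-integral `0`. Since `μ₁` charges only `ξ₀, …, ξₖ`, this is a triangular
linear system in the values `G(μ, ξᵢ)` with nonzero diagonal. Thus `G` vanishes at all atoms of `μ`.

Density (`DyadicPartition.mem_closure_graph`). Conditional expectations of a test function on the
cells are step functions and converge `ν₀`-a.e. by martingale convergence. A `ν₀`-null set is null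
for almost every `μ`, so dominated convergence gives convergence in the graph norm. -/

namespace TwoParamDirichlet

noncomputable section

/-! ### Closed forms -/

/-! ### Forms on a Hilbert space: semicontinuity, closure, relaxation and Mosco convergence. -/

namespace SymForm

variable {H : Type*} [NormedAddCommGroup H] [InnerProductSpace ℝ H]

theorem energy_coe (q : SymForm H) (u : q.dom) :
    q.energy (u : H) = ENNReal.ofReal (q.form u u) := by
  simp [energy]

theorem energy_le_iff (q : SymForm H) (u : H) {c : ℝ} (hc : 0 ≤ c) :
    q.energy u ≤ ENNReal.ofReal c ↔ ∃ h : u ∈ q.dom, q.form ⟨u, h⟩ ⟨u, h⟩ ≤ c := by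
  unfold energy
  split_ifs with h
  · simp [h, ENNReal.ofReal_le_ofReal_iff hc]
  · simp [h]

theorem parallelogram (q : SymForm H) (u v : q.dom) :
    q.form (u + v) (u + v) + q.form (u - v) (u - v) = 2 * q.form u u + 2 * q.form v v := by
  simp only [map_add, map_sub, LinearMap.add_apply, LinearMap.sub_apply]
  ring

/-- The quadratic functional of a closed form is lower semicontinuous. -/
theorem Closed.lowerSemicontinuous {q : SymForm H} (hq : q.Closed) :
    LowerSemicontinuous q.energy := by
  intro u c hc
  by_contra hcon
  have hctop : c ≠ ⊤ := (hc.trans_le le_top).ne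
  set r : ℝ := c.toReal
  have hr : ENNReal.ofReal r = c := ENNReal.ofReal_toReal hctop
  have hr0 : 0 ≤ r := ENNReal.toReal_nonneg
  -- If semicontinuity fails at `u`, there are points of energy at most `r` arbitrarily close to
  -- `u`.
  have hnear : ∀ ε > 0, ∃ v : q.dom, dist (v : H) u < ε ∧ q.form v v ≤ r := by
    intro ε hε
    by_contra! h
    refine hcon (Filter.mem_of_superset (Metric.ball_mem_nhds u hε) fun v hv => ?_)
    by_contra hle
    rw [Set.mem_ofPred_eq, not_lt, ← hr, q.energy_le_iff _ hr0] at hle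
    obtain ⟨hv', hle⟩ := hle
    exact (h ⟨v, hv'⟩ hv).not_ge hle
  -- `L n`, the infimum of `A n`, is the least energy in the ball of radius `1 / (n + 1)` about `u`.
  -- Near-minimisers form a Cauchy sequence for the form, as in the projection onto a convex set.
  let A : ℕ → Set ℝ := fun n =>
    {x | ∃ v : q.dom, dist (v : H) u < 1 / ((n : ℝ) + 1) ∧ q.form v v = x}
  have hAbdd : ∀ n, BddBelow (A n) := fun n => ⟨0, by rintro x ⟨v, -, rfl⟩; exact q.nonneg v⟩
  have hpos : ∀ n : ℕ, (0 : ℝ) < 1 / ((n : ℝ) + 1) := fun n => by positivity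
  have hAne : ∀ n, (A n).Nonempty := fun n =>
    let ⟨v, hv, _⟩ := hnear _ (hpos n)
    ⟨_, v, hv, rfl⟩
  let L : ℕ → ℝ := fun n => sInf (A n)
  have hLr : ∀ n, L n ≤ r := fun n =>
    let ⟨v, hv, hv'⟩ := hnear _ (hpos n)
    (csInf_le (hAbdd n) ⟨v, hv, rfl⟩).trans hv'
  have hLmono : Monotone L := fun m n hmn =>
    csInf_le_csInf (hAbdd m) (hAne n) fun x ⟨v, hv, hx⟩ =>
      ⟨v, hv.trans_le (one_div_le_one_div_of_le (by positivity) (by gcongr)), hx⟩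
  have hLlim : Tendsto L atTop (𝓝 (⨆ n, L n)) :=
    tendsto_atTop_ciSup hLmono ⟨r, by rintro _ ⟨n, rfl⟩; exact hLr n⟩
  have hlim0 : Tendsto (fun n : ℕ => 1 / ((n : ℝ) + 1)) atTop (𝓝 0) :=
    tendsto_one_div_add_atTop_nhds_zero_nat
  have hv : ∀ n : ℕ, ∃ v : q.dom, dist (v : H) u < 1 / ((n : ℝ) + 1) ∧
      q.form v v < L n + 1 / ((n : ℝ) + 1) := fun n => by
    obtain ⟨x, ⟨v, hv, rfl⟩, hx⟩ := exists_lt_of_csInf_lt (hAne n)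
      (lt_add_of_pos_right (sInf (A n)) (hpos n))
    exact ⟨v, hv, hx⟩
  choose v hvd hvq using hv
  have hvlim : Tendsto (fun n => (v n : H)) atTop (𝓝 u) :=
    tendsto_iff_dist_tendsto_zero.2
      (squeeze_zero (fun _ => dist_nonneg) (fun n => (hvd n).le) hlim0)
  have hkey : ∀ n m : ℕ, n ≤ m →
      q.form (v m - v n) (v m - v n) ≤ 2 * (L m - L n) + 4 * (1 / ((n : ℝ) + 1)) := by
    intro n m hnm
    have hle : 1 / ((m : ℝ) + 1) ≤ 1 / ((n : ℝ) + 1) :=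
      one_div_le_one_div_of_le (by positivity) (by gcongr)
    -- The midpoint stays in the larger ball, so its energy is at least `L n`; the parallelogram
    -- identity turns this into a bound on the difference.
    have hmid : L n ≤ q.form ((1 / 2 : ℝ) • (v m + v n)) ((1 / 2 : ℝ) • (v m + v n)) := by
      refine csInf_le (hAbdd n) ⟨_, ?_, rfl⟩
      have h1 : ‖(v m : H) - u‖ < 1 / ((n : ℝ) + 1) := by
        rw [← dist_eq_norm]; exact (hvd m).trans_le hle
      have h2 : ‖(v n : H) - u‖ < 1 / ((n : ℝ) + 1) := by
        rw [← dist_eq_norm]; exact hvd n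
      rw [dist_eq_norm]
      have h3 : (((1 / 2 : ℝ) • (v m + v n) : q.dom) : H) - u =
          (1 / 2 : ℝ) • (((v m : H) - u) + ((v n : H) - u)) := by
        push_cast
        module
      rw [h3, norm_smul, Real.norm_of_nonneg (by norm_num)]
      linarith [norm_add_le ((v m : H) - u) ((v n : H) - u)]
    have hpar := q.parallelogram (v m) (v n)
    rw [map_smul, map_smul, LinearMap.smul_apply, smul_eq_mul, smul_eq_mul] at hmid
    linarith [hvq m, hvq n]
  obtain ⟨w, hw1, hw2⟩ := hq v hvlim.cauchySeq (by
    intro ε hε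
    have hC : CauchySeq L := hLlim.cauchySeq
    obtain ⟨N₁, hN₁⟩ := Metric.cauchySeq_iff.1 hC (ε / 8) (by positivity)
    obtain ⟨N₂, hN₂⟩ :=
      (hlim0.eventually_lt_const (show (0 : ℝ) < ε / 8 by positivity)).exists_forall_of_atTop
    have aux : ∀ n m : ℕ, max N₁ N₂ ≤ n → n ≤ m → q.form (v m - v n) (v m - v n) < ε := by
      intro n m hn hnm
      have h1 := hN₁ m ((le_max_left _ _).trans (hn.trans hnm)) n ((le_max_left _ _).trans hn)
      have h2 := hN₂ n ((le_max_right _ _).trans hn)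
      rw [Real.dist_eq] at h1
      linarith [hkey n m hnm, le_abs_self (L m - L n)]
    refine ⟨max N₁ N₂, fun m hm n hn => ?_⟩
    rcases le_total n m with h | h
    · exact aux n m hn h
    · have := aux m n hm h
      rwa [← neg_sub (v m) (v n), map_neg, map_neg, LinearMap.neg_apply, neg_neg] at this)
  obtain rfl : u = w := tendsto_nhds_unique hvlim hw1
  refine hc.not_ge ?_
  rw [q.energy_coe, ← hr]
  refine ENNReal.ofReal_le_ofReal (le_of_forall_pos_le_add fun δ hδ => ?_)
  -- `q(w) ≤ (1 + t) q(vₙ) + (1 + t⁻¹) q(vₙ - w)`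
  set t : ℝ := δ / (2 * (r + 1))
  have ht : 0 < t := by positivity
  have hbd : ∀ n : ℕ, q.form w w ≤
      (1 + t) * (r + 1 / ((n : ℝ) + 1)) + (1 + t⁻¹) * q.form (v n - w) (v n - w) := by
    intro n
    -- This quantity is exactly the right side minus the left side of `h2`.
    have h0 := mul_nonneg ht.le (q.nonneg (v n + t⁻¹ • (v n - w)))
    have hs := q.symm (v n) w
    have h1 : q.form (v n) (v n) ≤ r + 1 / ((n : ℝ) + 1) := by linarith [hvq n, hLr n]
    have h2 : q.form w w ≤ (1 + t) * q.form (v n) (v n) +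
        (1 + t⁻¹) * q.form (v n - w) (v n - w) := by
      simp only [map_add, map_sub, LinearMap.add_apply, LinearMap.sub_apply, map_smul,
        LinearMap.smul_apply, smul_eq_mul] at h0 ⊢
      rw [← hs] at h0 ⊢
      have e1 : t * t⁻¹ = 1 := mul_inv_cancel₀ ht.ne'
      have e2 : ∀ x : ℝ, t * (t⁻¹ * x) = x := fun x => by rw [← mul_assoc, e1, one_mul]
      simp only [mul_add, mul_sub, e2] at h0
      linarith
    have : (1 + t) * q.form (v n) (v n) ≤ (1 + t) * (r + 1 / ((n : ℝ) + 1)) :=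
      mul_le_mul_of_nonneg_left h1 (by positivity)
    linarith
  have hlimR : Tendsto (fun n : ℕ => (1 + t) * (r + 1 / ((n : ℝ) + 1)) +
      (1 + t⁻¹) * q.form (v n - w) (v n - w)) atTop (𝓝 ((1 + t) * (r + 0) + (1 + t⁻¹) * 0)) :=
    ((hlim0.const_add r).const_mul _).add (hw2.const_mul _)
  have hfin := ge_of_tendsto' hlimR hbd
  have : t * r ≤ δ := by
    have : t * (2 * (r + 1)) = δ := div_mul_cancel₀ _ (by positivity)
    nlinarith
  linarith

theorem convex_energy_le (q : SymForm H) {c : ℝ} (hc : 0 ≤ c) :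
    Convex ℝ {u | q.energy u ≤ ENNReal.ofReal c} := by
  intro u hu v hv a b ha hb hab
  simp only [Set.mem_ofPred_eq, q.energy_le_iff _ hc] at *
  obtain ⟨hu, hu'⟩ := hu
  obtain ⟨hv, hv'⟩ := hv
  refine ⟨q.dom.add_mem (q.dom.smul_mem a hu) (q.dom.smul_mem b hv), ?_⟩
  set x : q.dom := ⟨u, hu⟩
  set y : q.dom := ⟨v, hv⟩
  change q.form (a • x + b • y) (a • x + b • y) ≤ c
  -- Convexity holds because `a q(x) + b q(y) - q(a x + b y) = a b q(x - y)` when `a + b = 1`.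
  have h := mul_nonneg (mul_nonneg ha hb) (q.nonneg (x - y))
  have hs := q.symm x y
  obtain rfl : b = 1 - a := by linarith
  simp only [map_add, map_sub, LinearMap.add_apply, LinearMap.sub_apply, map_smul,
    LinearMap.smul_apply, smul_eq_mul] at h ⊢
  rw [← hs] at h ⊢
  nlinarith [mul_le_mul_of_nonneg_left hu' ha, mul_le_mul_of_nonneg_left hv' hb]

/-- A lower semicontinuous form is weakly sequentially lower semicontinuous. -/
theorem energy_le_liminf_of_weak [CompleteSpace H] {q : SymForm H}
    (hq : LowerSemicontinuous q.energy) {u : ℕ → H} {w : H}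
    (hu : ∀ v : H, Tendsto (fun k => inner ℝ (u k) v) atTop (𝓝 (inner ℝ w v))) :
    q.energy w ≤ liminf (fun k => q.energy (u k)) atTop := by
  by_contra! hlt
  obtain ⟨c, hc1, hc2⟩ := exists_between hlt
  have hctop : c ≠ ⊤ := (hc2.trans_le le_top).ne
  rw [← ENNReal.ofReal_toReal hctop] at hc1 hc2
  have hfreq : ∃ᶠ k in atTop, q.energy (u k) < ENNReal.ofReal c.toReal :=
    frequently_lt_of_liminf_lt (by isBoundedDefault) hc1
  -- The sublevel set is convex and norm closed and contains `u k` for infinitely many `k`. A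
  -- functional separating `w` from it contradicts weak convergence.
  obtain ⟨f, s, hfw, hfs⟩ := geometric_hahn_banach_point_closed
    (q.convex_energy_le (c := c.toReal) ENNReal.toReal_nonneg)
    (hq.isClosed_preimage (ENNReal.ofReal c.toReal)) (x := w) (by simpa using hc2)
  set h := (InnerProductSpace.toDual ℝ H).symm f
  have hf : ∀ x, f x = inner ℝ x h := fun x => by
    rw [real_inner_comm]; exact (InnerProductSpace.toDual_symm_apply (x := x) (y := f)).symm
  rw [hf] at hfw
  have hev := (hu h).eventually_lt_const hfw
  obtain ⟨k, hk1, hk2⟩ := (hfreq.and_eventually hev).exists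
  have := hfs (u k) hk1.le
  rw [hf] at this
  linarith

end SymForm

/-! ### Forms given by a closed graph -/

section Graph

variable {H K : Type*} [NormedAddCommGroup H] [InnerProductSpace ℝ H]
  [NormedAddCommGroup K] [InnerProductSpace ℝ K]

/-- `W` is the graph of a (single-valued) partial operator from `H` to `K`. -/
def IsGraph (W : Submodule ℝ (WithLp 2 (H × K))) : Prop :=
  ∀ w ∈ W, w.fst = 0 → w.snd = 0

variable {W : Submodule ℝ (WithLp 2 (H × K))}

theorem IsGraph.mono (hW : IsGraph W) {W' : Submodule ℝ (WithLp 2 (H × K))} (h : W' ≤ W) :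
    IsGraph W' := fun w hw => hW w (h hw)

theorem IsGraph.injective (hW : IsGraph W) :
    Function.Injective ((WithLp.fstₗ 2 ℝ H K).comp W.subtype) := by
  rw [← LinearMap.ker_eq_bot, LinearMap.ker_eq_bot']
  rintro ⟨w, hw⟩ h
  have h1 : w.fst = 0 := h
  have h2 := hW w hw h1
  ext1
  exact (WithLp.ofLp_injective 2) (Prod.ext h1 h2)

/-- The partial operator with graph `W`. -/
def IsGraph.op (hW : IsGraph W) : LinearMap.range ((WithLp.fstₗ 2 ℝ H K).comp W.subtype) →ₗ[ℝ] K :=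
  ((WithLp.sndₗ 2 ℝ H K).comp W.subtype).comp
    (LinearEquiv.ofInjective _ hW.injective).symm.toLinearMap

theorem IsGraph.op_fst (hW : IsGraph W) {w : WithLp 2 (H × K)} (hw : w ∈ W)
    (h : w.fst ∈ LinearMap.range ((WithLp.fstₗ 2 ℝ H K).comp W.subtype)) :
    hW.op ⟨w.fst, h⟩ = w.snd := by
  have : (LinearEquiv.ofInjective _ hW.injective).symm ⟨w.fst, h⟩ = ⟨w, hw⟩ := by
    rw [LinearEquiv.symm_apply_eq]; rfl
  simp only [op, LinearMap.comp_apply, LinearEquiv.coe_coe, this]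
  rfl

/-- The form `(u, v) ↦ ⟨A u, A v⟩` of the partial operator `A` with graph `W`. -/
def IsGraph.form (hW : IsGraph W) : SymForm H where
  dom := LinearMap.range ((WithLp.fstₗ 2 ℝ H K).comp W.subtype)
  form := (innerₗ K).compl₁₂ hW.op hW.op
  symm _ _ := real_inner_comm _ _
  nonneg _ := real_inner_self_nonneg

theorem IsGraph.fst_mem_dom (hW : IsGraph W) {w : WithLp 2 (H × K)} (hw : w ∈ W) :
    w.fst ∈ hW.form.dom := ⟨⟨w, hw⟩, rfl⟩

theorem IsGraph.exists_of_mem_dom (hW : IsGraph W) {u : H} (hu : u ∈ hW.form.dom) :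
    ∃ w ∈ W, w.fst = u := by
  obtain ⟨w, rfl⟩ := hu
  exact ⟨w, w.2, rfl⟩

theorem IsGraph.form_fst (hW : IsGraph W) {w w' : WithLp 2 (H × K)} (hw : w ∈ W) (hw' : w' ∈ W) :
    hW.form.form ⟨w.fst, hW.fst_mem_dom hw⟩ ⟨w'.fst, hW.fst_mem_dom hw'⟩ =
      inner ℝ w.snd w'.snd := congrArg₂ (inner ℝ) (hW.op_fst hw _) (hW.op_fst hw' _)

theorem IsGraph.energy_fst (hW : IsGraph W) {w : WithLp 2 (H × K)} (hw : w ∈ W) :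
    hW.form.energy w.fst = ENNReal.ofReal (‖w.snd‖ ^ 2) := by
  rw [SymForm.energy, dif_pos (hW.fst_mem_dom hw), hW.form_fst hw hw, real_inner_self_eq_norm_sq]

theorem continuous_fst_withLp : Continuous fun w : WithLp 2 (H × K) => w.fst :=
  (WithLp.fstL 2 ℝ H K).continuous

theorem continuous_snd_withLp : Continuous fun w : WithLp 2 (H × K) => w.snd :=
  (WithLp.sndL 2 ℝ H K).continuous

/-- The norm `q(u, u) + ‖u‖²` is the squared graph norm transported by the first coordinate, so
closedness of the form is completeness of `W`. -/
theorem IsGraph.closed_form [CompleteSpace H] [CompleteSpace K] (hW : IsGraph W)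
    (hcl : IsClosed (W : Set (WithLp 2 (H × K)))) : hW.form.Closed := by
  intro u hu hform
  choose w hwW hwu using fun n => hW.exists_of_mem_dom (u n).2
  have hsub : ∀ m n, hW.form.form (u m - u n) (u m - u n) = ‖(w m).snd - (w n).snd‖ ^ 2 := by
    intro m n
    have h := hW.form_fst (W.sub_mem (hwW m) (hwW n)) (W.sub_mem (hwW m) (hwW n))
    rw [real_inner_self_eq_norm_sq] at h
    rw [← WithLp.sub_snd, ← h]
    have : u m - u n = ⟨(w m - w n).fst, hW.fst_mem_dom (W.sub_mem (hwW m) (hwW n))⟩ :=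
      Subtype.ext (by simp [hwu])
    rw [this]
  have hc1 : CauchySeq fun n => (w n).fst := by simpa only [hwu] using hu
  have hc2 : CauchySeq fun n => (w n).snd := by
    rw [Metric.cauchySeq_iff]
    intro ε hε
    obtain ⟨N, hN⟩ := hform (ε ^ 2) (by positivity)
    refine ⟨N, fun m hm n hn => ?_⟩
    have := hN m hm n hn
    rw [hsub] at this
    rw [dist_eq_norm]
    exact lt_of_pow_lt_pow_left₀ 2 hε.le this
  obtain ⟨x, hx⟩ := cauchySeq_tendsto_of_complete hc1
  obtain ⟨y, hy⟩ := cauchySeq_tendsto_of_complete hc2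
  have hlim : Tendsto w atTop (𝓝 (WithLp.toLp 2 (x, y))) :=
    ((WithLp.prod_continuous_toLp 2 H K).tendsto (x, y)).comp (hx.prodMk_nhds hy)
  have hmem : WithLp.toLp 2 (x, y) ∈ W := hcl.mem_of_tendsto hlim (Eventually.of_forall hwW)
  refine ⟨⟨x, hW.fst_mem_dom hmem⟩, by simpa only [hwu] using hx, ?_⟩
  have hval : ∀ n, hW.form.form (u n - ⟨x, hW.fst_mem_dom hmem⟩) (u n - ⟨x, hW.fst_mem_dom hmem⟩) =
      ‖(w n).snd - y‖ ^ 2 := by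
    intro n
    have h := hW.form_fst (W.sub_mem (hwW n) hmem) (W.sub_mem (hwW n) hmem)
    rw [real_inner_self_eq_norm_sq] at h
    have : u n - ⟨x, hW.fst_mem_dom hmem⟩ =
        ⟨(w n - WithLp.toLp 2 (x, y)).fst, hW.fst_mem_dom (W.sub_mem (hwW n) hmem)⟩ :=
      Subtype.ext (by simp [hwu])
    rw [this, h]
    simp
  simp only [hval]
  have := (tendsto_iff_norm_sub_tendsto_zero.1 hy).pow 2
  simpa using this

variable {ι : Type*}

/-- Closable gradient forms on an increasing sequence of classes of functions, together dense in
the graph norm: the closures exist and Mosco converge to the relaxation. -/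
theorem exists_closure_relaxation_mosco [CompleteSpace H] [CompleteSpace K]
    (J : ι → H) (D : ι → K) (e : ι → ι → ℝ) (he : ∀ F G, e F G = inner ℝ (D F) (D G))
    (C : ℕ → Set ι) (Γ : ℕ → Submodule ℝ (WithLp 2 (H × K)))
    (hΓ : ∀ k w, w ∈ Γ k ↔ ∃ F ∈ C k, WithLp.toLp 2 (J F, D F) = w) (hmono : Monotone Γ)
    (hdense : ∀ F, WithLp.toLp 2 (J F, D F) ∈ (⨆ k, Γ k).topologicalClosure)
    (hclosable : ∀ (F : ℕ → ι) (g : K), Tendsto (fun n => J (F n)) atTop (𝓝 0) →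
      Tendsto (fun n => D (F n)) atTop (𝓝 g) → g = 0) :
    ∃ (q : ℕ → SymForm H) (Ξ : SymForm H),
      (∀ k, IsClosureOf (q k) J e (C k)) ∧ IsRelaxation Ξ J e Set.univ ∧ MoscoTendsto q Ξ := by
  set W := (⨆ k, Γ k).topologicalClosure
  have hseq : ∀ (V : Submodule ℝ (WithLp 2 (H × K))) (w), w ∈ V.topologicalClosure →
      ∃ x : ℕ → WithLp 2 (H × K), (∀ n, x n ∈ V) ∧ Tendsto x atTop (𝓝 w) := fun V w hw =>
    mem_closure_iff_seq_limit.1 hw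
  -- A point of `W` is a limit of graph points of functions from varying classes, so closability is
  -- needed for sequences in the union of the classes.
  have hW : IsGraph W := by
    intro w hw h0
    obtain ⟨x, hx, hxw⟩ := hseq _ w hw
    have : ∀ n, ∃ F, WithLp.toLp 2 (J F, D F) = x n := fun n => by
      obtain ⟨k, hk⟩ := (Submodule.mem_iSup_of_directed _ hmono.directed_le).1 (hx n)
      obtain ⟨F, -, hF⟩ := (hΓ k _).1 hk
      exact ⟨F, hF⟩
    choose F hF using this
    have h1 := (continuous_fst_withLp.tendsto w).comp hxw
    have h2 := (continuous_snd_withLp.tendsto w).comp hxw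
    refine hclosable F w.snd ?_ ?_
    · rw [h0] at h1
      refine h1.congr fun n => ?_
      simp [← hF]
    · refine h2.congr fun n => ?_
      simp [← hF]
  have hle : ∀ k, (Γ k).topologicalClosure ≤ W := fun k =>
    Submodule.topologicalClosure_mono (le_iSup Γ k)
  have hWk : ∀ k, IsGraph (Γ k).topologicalClosure := fun k => hW.mono (hle k)
  have hlsc : LowerSemicontinuous hW.form.energy :=
    (hW.closed_form (Submodule.isClosed_topologicalClosure _)).lowerSemicontinuous
  refine ⟨fun k => (hWk k).form, hW.form, fun k => ?_, ⟨⟨hlsc, ?_⟩, ?_⟩, ?_, ?_⟩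
  · have hin : ∀ F ∈ C k, WithLp.toLp 2 (J F, D F) ∈ (Γ k).topologicalClosure := fun F hF =>
      Submodule.le_topologicalClosure _ ((hΓ k _).2 ⟨F, hF, rfl⟩)
    refine ⟨(hWk k).closed_form (Submodule.isClosed_topologicalClosure _), ?_, ?_⟩
    · intro F hF G hG
      refine ⟨(hWk k).fst_mem_dom (hin F hF), (hWk k).fst_mem_dom (hin G hG), ?_⟩
      rw [he]
      exact (hWk k).form_fst (hin F hF) (hin G hG)
    · intro u hu
      obtain ⟨w, hw, rfl⟩ := (hWk k).exists_of_mem_dom hu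
      obtain ⟨x, hx, hxw⟩ := hseq _ w hw
      choose F hFC hF using fun n => (hΓ k _).1 (hx n)
      have hJ : ∀ n, J (F n) = (x n).fst := fun n => by rw [← hF]; rfl
      refine ⟨F, hFC, ?_, ?_⟩
      · simp only [hJ]
        exact (continuous_fst_withLp.tendsto w).comp hxw
      · have hE : ∀ n, (hWk k).form.energy (J (F n) - w.fst) =
            ENNReal.ofReal (‖(x n).snd - w.snd‖ ^ 2) := fun n => by
          have hmem := (Γ k).topologicalClosure.sub_mem
            (Submodule.le_topologicalClosure _ (hx n)) hw
          rw [hJ, ← WithLp.sub_fst, (hWk k).energy_fst hmem, WithLp.sub_snd]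
        simp only [hE]
        have h2 := tendsto_iff_norm_sub_tendsto_zero.1
          ((continuous_snd_withLp.tendsto w).comp hxw)
        simpa using ENNReal.tendsto_ofReal (h2.pow 2)
  · intro F _
    have := hW.energy_fst (hdense F)
    rw [he, real_inner_self_eq_norm_sq]
    exact this.le
  -- A competitor is at most `‖D (F n)‖²` along a sequence converging to `w` in both coordinates,
  -- and its semicontinuity passes this to the limit.
  · rintro p ⟨hp, hpe⟩ u
    by_cases hu : u ∈ hW.form.dom
    · obtain ⟨w, hw, rfl⟩ := hW.exists_of_mem_dom hu
      obtain ⟨x, hx, hxw⟩ := hseq _ w hw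
      have : ∀ n, ∃ F, WithLp.toLp 2 (J F, D F) = x n := fun n => by
        obtain ⟨k, hk⟩ := (Submodule.mem_iSup_of_directed _ hmono.directed_le).1 (hx n)
        obtain ⟨F, -, hF⟩ := (hΓ k _).1 hk
        exact ⟨F, hF⟩
      choose F hF using this
      have h1 := (continuous_fst_withLp.tendsto w).comp hxw
      have h2 := ENNReal.tendsto_ofReal
        (((continuous_snd_withLp.tendsto w).comp hxw).norm.pow 2)
      rw [hW.energy_fst hw, ← h2.liminf_eq]
      refine ((lowerSemicontinuous_iff_le_liminf.1 hp w.fst).trans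
        (liminf_le_liminf_of_le h1)).trans ?_
      rw [← Filter.liminf_comp]
      refine liminf_le_liminf (Eventually.of_forall fun n => ?_)
      have := hpe (F n) (Set.mem_univ _)
      rw [he, real_inner_self_eq_norm_sq] at this
      simpa [← hF] using this
    · rw [SymForm.energy.eq_1 hW.form, dif_neg hu]
      exact le_top
  -- Each `q k` is a restriction of `Ξ`, so its energy is the larger of the two.
  · intro u w huw
    refine (SymForm.energy_le_liminf_of_weak hlsc huw).trans
      (liminf_le_liminf (Eventually.of_forall fun k => ?_))
    by_cases hu : u k ∈ (hWk k).form.dom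
    · obtain ⟨x, hx, hxu⟩ := (hWk k).exists_of_mem_dom hu
      simp only [← hxu]
      rw [(hWk k).energy_fst hx, hW.energy_fst (hle k hx)]
    · change _ ≤ (hWk k).form.energy (u k)
      rw [SymForm.energy, SymForm.energy, dif_neg hu]
      exact le_top
  · intro u
    by_cases hu : u ∈ hW.form.dom
    · obtain ⟨w, hw, rfl⟩ := hW.exists_of_mem_dom hu
      have hsup : (⨆ k, (Γ k).topologicalClosure).topologicalClosure = W := by
        refine le_antisymm ?_ (Submodule.topologicalClosure_mono
          (iSup_mono fun k => Submodule.le_topologicalClosure _))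
        exact Submodule.topologicalClosure_minimal _ (iSup_le hle)
          (Submodule.isClosed_topologicalClosure _)
      have : ∀ k, CompleteSpace (Γ k).topologicalClosure := fun k =>
        (Submodule.isClosed_topologicalClosure _).completeSpace_coe
      have : CompleteSpace (⨆ k, (Γ k).topologicalClosure).topologicalClosure :=
        (Submodule.isClosed_topologicalClosure _).completeSpace_coe
      -- The recovery sequence: projecting in the product space makes the function and its gradient
      -- converge at the same time.
      have hproj := Submodule.starProjection_tendsto_closure_iSup
        (fun k => (Γ k).topologicalClosure)
        (fun _ _ h => Submodule.topologicalClosure_mono (hmono h)) w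
      rw [Submodule.starProjection_eq_self_iff.2 (by rw [hsup]; exact hw)] at hproj
      refine ⟨fun k => ((Γ k).topologicalClosure.starProjection w).fst,
        (continuous_fst_withLp.tendsto w).comp hproj, ?_⟩
      have hE : ∀ k, (hWk k).form.energy ((Γ k).topologicalClosure.starProjection w).fst =
          ENNReal.ofReal (‖((Γ k).topologicalClosure.starProjection w).snd‖ ^ 2) := fun k =>
        (hWk k).energy_fst (Submodule.starProjection_apply_mem _ w)
      simp only [hE]
      rw [hW.energy_fst hw]
      exact (ENNReal.tendsto_ofReal
        (((continuous_snd_withLp.tendsto w).comp hproj).norm.pow 2)).limsup_eq.le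
    · refine ⟨fun _ => u, tendsto_const_nhds, ?_⟩
      rw [SymForm.energy.eq_1 hW.form, dif_neg hu]
      exact le_top

end Graph

end

end TwoParamDirichlet

/-! ### The Dirichlet law with the weights in stick-breaking order. -/

namespace TwoParamDirichlet

noncomputable section

/-! ### Beta distributions -/

theorem measurable_betaPDF (a b : ℝ) : Measurable (betaPDF a b) :=
  (measurable_betaPDFReal a b).ennreal_ofReal

theorem ae_betaMeasure_mem_Ioo (a b : ℝ) : ∀ᵐ x ∂betaMeasure a b, x ∈ Set.Ioo (0 : ℝ) 1 := by
  rw [betaMeasure, ae_withDensity_iff (measurable_betaPDF a b)]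
  refine Eventually.of_forall fun x hx => ?_
  by_contra h
  apply hx
  rw [Set.mem_Ioo, not_and_or, not_lt, not_lt] at h
  rcases h with h | h
  · exact betaPDF_eq_zero_of_nonpos h
  · exact betaPDF_eq_zero_of_one_le h

theorem beta_add_one {a b : ℝ} (ha : 0 < a) (hb : 0 < b) :
    beta a (b + 1) = beta a b * (b / (a + b)) := by
  have hab : Real.Gamma (a + b) ≠ 0 := (Real.Gamma_pos_of_pos (by positivity)).ne'
  rw [beta, beta, Real.Gamma_add_one hb.ne', ← add_assoc, Real.Gamma_add_one (by positivity)]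
  field_simp

theorem lintegral_one_sub_betaMeasure {a b : ℝ} (ha : 0 < a) (hb : 0 < b) :
    ∫⁻ x, ENNReal.ofReal (1 - x) ∂betaMeasure a b = ENNReal.ofReal (b / (a + b)) := by
  rw [betaMeasure, lintegral_withDensity_eq_lintegral_mul _ (measurable_betaPDF a b) (by fun_prop)]
  -- The factor `1 - x` raises the second parameter by one; the constant is the ratio of the two
  -- beta integrals.
  have h : ∀ x, (betaPDF a b * fun x => ENNReal.ofReal (1 - x)) x =
      ENNReal.ofReal (b / (a + b)) * betaPDF a (b + 1) x := by
    intro x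
    simp only [Pi.mul_apply]
    rcases le_or_gt x 0 with h0 | h0
    · simp [betaPDF_eq_zero_of_nonpos h0]
    rcases le_or_gt 1 x with h1 | h1
    · simp [betaPDF_eq_zero_of_one_le h1]
    have h1' : 0 < 1 - x := by linarith
    have hB := beta_pos ha hb
    rw [betaPDF_of_pos_lt_one h0 h1, betaPDF_of_pos_lt_one h0 h1, ← ENNReal.ofReal_mul (by positivity),
      ← ENNReal.ofReal_mul (by positivity), beta_add_one ha hb, add_sub_right_comm,
      Real.rpow_add_one h1'.ne']
    congr 1
    field_simp
  simp_rw [h]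
  rw [lintegral_const_mul _ (measurable_betaPDF _ _), lintegral_betaPDF_eq_one ha (by positivity), mul_one]

/-! ### Stick breaking -/

/-- The length of stick left after `n` breaks. -/
def remainder (U : ℕ → ℝ) (n : ℕ) : ℝ := ∏ i ∈ Finset.range n, (1 - U i)

theorem sum_stick (U : ℕ → ℝ) (n : ℕ) :
    ∑ i ∈ Finset.range n, stick U i = 1 - remainder U n := by
  induction n with
  | zero => simp [remainder]
  | succ n ih =>
    rw [Finset.sum_range_succ, ih, remainder, remainder, Finset.prod_range_succ, stick]
    ring

/-- Break fractions in `[0, 1]` which use up the whole stick. -/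
structure IsStick (U : ℕ → ℝ) : Prop where
  mem : ∀ i, U i ∈ Set.Icc (0 : ℝ) 1
  lim : Tendsto (remainder U) atTop (𝓝 0)

theorem remainder_nonneg {U : ℕ → ℝ} (h : ∀ i, U i ∈ Set.Icc (0 : ℝ) 1) (n : ℕ) :
    0 ≤ remainder U n :=
  Finset.prod_nonneg fun i _ => by linarith [(h i).2]

theorem remainder_le_one {U : ℕ → ℝ} (h : ∀ i, U i ∈ Set.Icc (0 : ℝ) 1) (n : ℕ) :
    remainder U n ≤ 1 :=
  Finset.prod_le_one (fun i _ => by linarith [(h i).2]) fun i _ => by linarith [(h i).1]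

theorem stick_nonneg {U : ℕ → ℝ} (h : ∀ i, U i ∈ Set.Icc (0 : ℝ) 1) (n : ℕ) : 0 ≤ stick U n :=
  mul_nonneg (remainder_nonneg h n) (h n).1

theorem stick_le_one {U : ℕ → ℝ} (h : ∀ i, U i ∈ Set.Icc (0 : ℝ) 1) (n : ℕ) : stick U n ≤ 1 :=
  mul_le_one₀ (remainder_le_one h n) (h n).1 (h n).2

theorem IsStick.hasSum {U : ℕ → ℝ} (h : IsStick U) : HasSum (stick U) 1 := by
  rw [hasSum_iff_tendsto_nat_of_nonneg (stick_nonneg h.mem)]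
  simp only [sum_stick]
  simpa using h.lim.const_sub 1

theorem stick_update_of_lt (U : ℕ → ℝ) {k n : ℕ} (h : n < k) (u : ℝ) :
    stick (Function.update U k u) n = stick U n := by
  rw [stick, stick, Function.update_of_ne h.ne]
  congr 1
  refine Finset.prod_congr rfl fun i hi => ?_
  rw [Function.update_of_ne ((Finset.mem_range.1 hi).trans h).ne]

theorem stick_update_self (U : ℕ → ℝ) (k : ℕ) (u : ℝ) :
    stick (Function.update U k u) k = remainder U k * u := by
  rw [stick, remainder, Function.update_self]
  congr 1
  refine Finset.prod_congr rfl fun i hi => ?_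
  rw [Function.update_of_ne (Finset.mem_range.1 hi).ne]

theorem remainder_update_of_lt (U : ℕ → ℝ) {k n : ℕ} (h : k < n) (u : ℝ) :
    remainder (Function.update U k u) n = (1 - u) * ∏ i ∈ (Finset.range n).erase k, (1 - U i) := by
  rw [remainder, ← Finset.mul_prod_erase _ _ (Finset.mem_range.2 h), Function.update_self]
  congr 1
  refine Finset.prod_congr rfl fun i hi => ?_
  rw [Function.update_of_ne (Finset.ne_of_mem_erase hi)]

theorem stick_update_of_gt (U : ℕ → ℝ) {k n : ℕ} (h : k < n) (u : ℝ) :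
    stick (Function.update U k u) n =
      (1 - u) * ((∏ i ∈ (Finset.range n).erase k, (1 - U i)) * U n) := by
  rw [stick, Function.update_of_ne h.ne', ← mul_assoc, ← remainder_update_of_lt U h u, remainder]

/-- Stick breaking is affine in each of the break fractions. -/
theorem stick_update (U : ℕ → ℝ) (k n : ℕ) (u : ℝ) :
    stick (Function.update U k u) n =
      (1 - u) * stick (Function.update U k 0) n + u * stick (Function.update U k 1) n := by
  rcases lt_trichotomy n k with h | rfl | h
  · simp only [stick_update_of_lt U h]; ring
  · simp only [stick_update_self]; ring
  · simp only [stick_update_of_gt U h]; ring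

/-- The condition `U k < 1` ensures that the remainder tends to `0` because of the other factors:
dividing by `1 - U k` removes the old fraction, and any new one may be inserted, including `1`. -/
theorem IsStick.update {U : ℕ → ℝ} (h : IsStick U) {k : ℕ} (hk : U k < 1) {u : ℝ}
    (hu : u ∈ Set.Icc (0 : ℝ) 1) : IsStick (Function.update U k u) := by
  refine ⟨fun i => ?_, ?_⟩
  · rcases eq_or_ne i k with rfl | hi
    · simpa using hu
    · rw [Function.update_of_ne hi]; exact h.mem i
  · have h1 : 1 - U k ≠ 0 := by linarith
    have h2 := h.lim.const_mul ((1 - u) / (1 - U k))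
    rw [mul_zero] at h2
    refine h2.congr' ((eventually_gt_atTop k).mono fun n hn => ?_)
    have h3 := remainder_update_of_lt U hn (U k)
    rw [Function.update_eq_self] at h3
    rw [h3, remainder_update_of_lt U hn u]
    field_simp

/-! ### The law of the break fractions -/

theorem isProbabilityMeasure_betaMeasure_stick {θ : ℝ} (hθ : -(1 / 2) < θ) (k : ℕ) :
    IsProbabilityMeasure (betaMeasure (1 - 1 / 2) (θ + (k + 1) * (1 / 2))) :=
  isProbabilityMeasureBeta (by norm_num) (by nlinarith [(Nat.cast_nonneg k : (0 : ℝ) ≤ k)])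

theorem isProbabilityMeasure_stickLaw {θ : ℝ} (hθ : -(1 / 2) < θ) :
    IsProbabilityMeasure (stickLaw (1 / 2) θ) := by
  have := isProbabilityMeasure_betaMeasure_stick hθ
  unfold stickLaw
  infer_instance

theorem ae_stickLaw_mem_Ioo {θ : ℝ} (hθ : -(1 / 2) < θ) :
    ∀ᵐ U ∂stickLaw (1 / 2) θ, ∀ i, U i ∈ Set.Ioo (0 : ℝ) 1 := by
  have := isProbabilityMeasure_betaMeasure_stick hθ
  rw [ae_all_iff]
  intro i
  have h := measurePreserving_eval_infinitePi
    (fun k : ℕ => betaMeasure (1 - 1 / 2) (θ + (k + 1) * (1 / 2))) i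
  exact h.quasiMeasurePreserving.ae (ae_betaMeasure_mem_Ioo _ _)

theorem prod_range_div_add_one {c : ℝ} (hc : 0 < c) (n : ℕ) :
    ∏ i ∈ Finset.range n, (c + i) / (c + i + 1) = c / (c + n) := by
  induction n with
  | zero => simp [hc.ne']
  | succ n ih =>
    rw [Finset.prod_range_succ, ih]
    have : 0 < c + n := by positivity
    push_cast
    field_simp
    ring

/-- With `c = 1 + 2θ` the mean of `1 - Uᵢ` is `(c + i) / (c + i + 1)`, so by independence the mean
remainder is a telescoping product. -/
theorem lintegral_remainder {θ : ℝ} (hθ : -(1 / 2) < θ) (n : ℕ) :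
    ∫⁻ U, ENNReal.ofReal (remainder U n) ∂stickLaw (1 / 2) θ =
      ENNReal.ofReal ((1 + 2 * θ) / (1 + 2 * θ + n)) := by
  have := isProbabilityMeasure_betaMeasure_stick hθ
  have hind : iIndepFun (fun (i : ℕ) (U : ℕ → ℝ) => ENNReal.ofReal (1 - U i))
      (stickLaw (1 / 2) θ) :=
    iIndepFun_infinitePi (X := fun _ x => ENNReal.ofReal (1 - x)) (by fun_prop)
  have h1 : ∀ᵐ U ∂stickLaw (1 / 2) θ, ENNReal.ofReal (remainder U n) =
      ∏ i ∈ Finset.range n, ENNReal.ofReal (1 - U i) := by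
    filter_upwards [ae_stickLaw_mem_Ioo hθ] with U hU
    exact ENNReal.ofReal_prod_of_nonneg fun i _ => by linarith [(hU i).2]
  have h2 : ∀ i : ℕ, ∫⁻ U, ENNReal.ofReal (1 - U i) ∂stickLaw (1 / 2) θ =
      ENNReal.ofReal ((1 + 2 * θ + i) / (1 + 2 * θ + i + 1)) := by
    intro i
    have hp : 0 < θ + (i + 1) * (1 / 2) := by nlinarith [(Nat.cast_nonneg i : (0 : ℝ) ≤ i)]
    have h := (measurePreserving_eval_infinitePi
      (fun k : ℕ => betaMeasure (1 - 1 / 2) (θ + (k + 1) * (1 / 2))) i).lintegral_comp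
        (f := fun x => ENNReal.ofReal (1 - x)) (by fun_prop)
    rw [lintegral_one_sub_betaMeasure (by norm_num) hp] at h
    refine Eq.trans h ?_
    congr 1
    have h3 : (1 + 2 * θ + i : ℝ) = 2 * (θ + (i + 1) * (1 / 2)) := by ring
    have h4 : (1 + 2 * θ + i + 1 : ℝ) = 2 * (1 - 1 / 2 + (θ + (i + 1) * (1 / 2))) := by ring
    rw [h4, h3, mul_div_mul_left _ _ two_ne_zero]
  rw [lintegral_congr_ae h1, lintegral_prod_eq_prod_lintegral_of_indepFun (Finset.range n) _ hind
    (fun i => by fun_prop)]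
  simp only [h2]
  rw [← ENNReal.ofReal_prod_of_nonneg, prod_range_div_add_one (by linarith)]
  intro i _
  have : 0 < 1 + 2 * θ := by linarith
  positivity

/-- The remainders decrease and their means tend to `0`, so their limit is `0` almost surely. -/
theorem ae_isStick {θ : ℝ} (hθ : -(1 / 2) < θ) : ∀ᵐ U ∂stickLaw (1 / 2) θ, IsStick U := by
  have hinf : ∫⁻ U, ⨅ n, ENNReal.ofReal (remainder U n) ∂stickLaw (1 / 2) θ = 0 := by
    have hlim : Tendsto (fun n : ℕ => ENNReal.ofReal ((1 + 2 * θ) / (1 + 2 * θ + n))) atTop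
        (𝓝 0) := by
      have h := tendsto_const_nhds (x := 1 + 2 * θ).div_atTop
        (tendsto_atTop_add_const_left atTop (1 + 2 * θ) tendsto_natCast_atTop_atTop)
      simpa using ENNReal.tendsto_ofReal h
    refine le_antisymm (ge_of_tendsto' hlim fun n => ?_) bot_le
    rw [← lintegral_remainder hθ]
    exact lintegral_mono fun U => iInf_le _ n
  have hmeas : Measurable fun U : ℕ → ℝ => ⨅ n, ENNReal.ofReal (remainder U n) := by
    unfold remainder
    fun_prop
  rw [lintegral_eq_zero_iff hmeas] at hinf
  filter_upwards [hinf, ae_stickLaw_mem_Ioo hθ] with U hU hU'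
  have hmem : ∀ i, U i ∈ Set.Icc (0 : ℝ) 1 := fun i => Set.Ioo_subset_Icc_self (hU' i)
  refine ⟨hmem, ?_⟩
  have hanti : Antitone (remainder U) := antitone_nat_of_succ_le fun n => by
    rw [remainder, remainder, Finset.prod_range_succ]
    exact mul_le_of_le_one_right (remainder_nonneg hmem n) (by linarith [(hmem n).1])
  have h := tendsto_atTop_iInf (f := fun n => ENNReal.ofReal (remainder U n))
    fun m n hmn => ENNReal.ofReal_le_ofReal (hanti hmn)
  rw [show (⨅ n, ENNReal.ofReal (remainder U n)) = 0 from hU] at h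
  have h' := (ENNReal.tendsto_toReal ENNReal.zero_ne_top).comp h
  simpa [Function.comp_def, ENNReal.toReal_ofReal (remainder_nonneg hmem _)] using h'

end

end TwoParamDirichlet

namespace TwoParamDirichlet

noncomputable section

/-! ### Descending rearrangement -/

theorem ranked_nonneg (v : ℕ → ℝ) (k : ℕ) : 0 ≤ ranked v k :=
  Real.sInf_nonneg fun _ ht => ht.1

/-- Expresses the counting condition through countably many finite sets, which yields the
measurability of `ranked`. -/
theorem le_natCast_encard_iff {A : Set ℕ} {k : ℕ} :
    A.encard ≤ k ↔ ∀ s : Finset ℕ, s.card = k + 1 → ∃ i ∈ s, i ∉ A := by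
  constructor
  · intro h s hs
    by_contra! hsA
    have h1 : (s : Set ℕ).encard ≤ A.encard := Set.encard_le_encard hsA
    rw [Set.encard_coe_eq_coe_finsetCard, hs] at h1
    exact absurd (h1.trans h) (by exact_mod_cast (Nat.lt_succ_self k).not_ge)
  · intro h
    by_contra! hlt
    have h1 : ((k + 1 : ℕ) : ℕ∞) ≤ A.encard := by
      push_cast
      exact Order.add_one_le_of_lt hlt
    obtain ⟨t, htA, ht⟩ := Set.exists_subset_encard_eq h1
    have htf : t.Finite := Set.finite_of_encard_eq_coe ht
    obtain ⟨i, hi, hiA⟩ := h htf.toFinset (by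
      rw [htf.encard_eq_coe_toFinset_card] at ht
      exact_mod_cast ht)
    exact hiA (htA (by simpa using hi))

/-- The infimum is attained: if `k + 1` terms exceed `t`, so does their minimum, and every level
below that minimum is excluded. Boundedness keeps the defining set nonempty; otherwise `sInf` would
be the default `0`. -/
theorem ranked_le_iff {v : ℕ → ℝ} (hv : BddAbove (Set.range v)) {k : ℕ} {t : ℝ} (ht : 0 ≤ t) :
    ranked v k ≤ t ↔ {i | t < v i}.encard ≤ k := by
  have hbdd : BddBelow {t : ℝ | 0 ≤ t ∧ {i | t < v i}.encard ≤ k} := ⟨0, fun _ h => h.1⟩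
  constructor
  · intro h
    rw [le_natCast_encard_iff]
    intro s hs
    by_contra! hsA
    simp only [Set.mem_ofPred_eq] at hsA
    have hne : s.Nonempty := Finset.card_pos.1 (by omega)
    set m := s.inf' hne v
    have hm : t < m := (Finset.lt_inf'_iff hne).2 hsA
    have hnonempty : {t : ℝ | 0 ≤ t ∧ {i | t < v i}.encard ≤ k}.Nonempty := by
      obtain ⟨C, hC⟩ := hv
      refine ⟨max C 0, le_max_right _ _, ?_⟩
      have : {i | max C 0 < v i} = ∅ := by
        ext i
        simp only [Set.mem_ofPred_eq, Set.mem_empty_iff_false, iff_false, not_lt]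
        exact (hC ⟨i, rfl⟩).trans (le_max_left _ _)
      rw [this, Set.encard_empty]
      exact zero_le
    obtain ⟨r, ⟨_, hr⟩, hrm⟩ := exists_lt_of_csInf_lt hnonempty (h.trans_lt hm)
    obtain ⟨i, hi, hi'⟩ := le_natCast_encard_iff.1 hr s hs
    exact hi' (hrm.trans_le (Finset.inf'_le v hi))
  · intro h
    exact csInf_le hbdd ⟨ht, h⟩

theorem measurable_ranked {Ω : Type*} [MeasurableSpace Ω] {f : Ω → ℕ → ℝ} (hf : Measurable f)
    (hbdd : ∀ x, BddAbove (Set.range (f x))) (k : ℕ) : Measurable fun x => ranked (f x) k := by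
  refine measurable_of_Iic fun t => ?_
  rcases lt_or_ge t 0 with ht | ht
  · convert MeasurableSet.empty
    ext x
    simpa using ht.trans_le (ranked_nonneg _ _)
  · have : (fun x => ranked (f x) k) ⁻¹' Set.Iic t =
        ⋂ s : Finset ℕ, ⋂ _ : s.card = k + 1, ⋃ i ∈ s, {x | f x i ≤ t} := by
      ext x
      simp [ranked_le_iff (hbdd x) ht, le_natCast_encard_iff]
    rw [this]
    refine MeasurableSet.iInter fun s => MeasurableSet.iInter fun _ =>
      Finset.measurableSet_biUnion s fun i _ => ?_
    exact measurableSet_le ((measurable_pi_apply i).comp hf) measurable_const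

theorem encard_setOf_natCast_lt {n : ℕ∞} : {k : ℕ | (k : ℕ∞) < n}.encard = n := by
  induction n using ENat.recTopCoe with
  | top => simp
  | coe n =>
    have : {k : ℕ | (k : ℕ∞) < n} = (Finset.range n : Set ℕ) := by ext; simp
    rw [this, Set.encard_coe_eq_coe_finsetCard, Finset.card_range]

/-- The descending rearrangement of a positive null sequence is a permutation of it. -/
theorem exists_perm_ranked {v : ℕ → ℝ} (hpos : ∀ i, 0 < v i) (hlim : Tendsto v atTop (𝓝 0)) :
    ∃ σ : Equiv.Perm ℕ, ∀ k, ranked v k = v (σ k) := by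
  have hbdd : BddAbove (Set.range v) := hlim.bddAbove_range
  have hfin : ∀ t > 0, {i | t < v i}.Finite := fun t ht => by
    have := hlim.eventually_lt_const ht
    rw [← Nat.cofinite_eq_atTop, Filter.eventually_cofinite] at this
    exact this.subset fun i hi => by simpa using (le_of_lt hi)
  have hrpos : ∀ k, 0 < ranked v k := fun k => by
    by_contra! h
    rw [ranked_le_iff hbdd le_rfl] at h
    simp [hpos] at h
  have hgt : ∀ t, 0 ≤ t → {k | t < ranked v k}.encard = {i | t < v i}.encard := fun t ht => by
    rw [← encard_setOf_natCast_lt (n := {i | t < v i}.encard)]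
    congr 1
    ext k
    simp only [Set.mem_ofPred_eq]
    rw [← not_le, ranked_le_iff hbdd ht, not_le]
  have hrfin : ∀ t > 0, {k | t < ranked v k}.Finite := fun t ht => by
    rw [← Set.encard_lt_top_iff, hgt t ht.le, Set.encard_lt_top_iff]
    exact hfin t ht
  -- The values do not accumulate at `s > 0`, so `{t < w}` with `t` just below `s` is already `{s ≤
  -- w}`. Counts for strict inequalities thus determine those for weak ones.
  have hgap : ∀ (w : ℕ → ℝ) (s : ℝ), 0 < s → {i | s / 2 < w i}.Finite →
      ∀ᶠ t in 𝓝[<] s, {i | t < w i} = {i | s ≤ w i} := by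
    intro w s hs hw
    have h1 : ∀ᶠ t in 𝓝[<] s, ∀ i ∈ {i | s / 2 < w i}, w i < s → w i < t := by
      rw [Filter.eventually_all_finite hw]
      intro i _
      by_cases hi : w i < s
      · filter_upwards [Ioo_mem_nhdsLT hi] with t ht _ using ht.1
      · exact Eventually.of_forall fun t h => absurd h hi
    filter_upwards [h1, Ioo_mem_nhdsLT (show s / 2 < s by linarith)] with t ht hts
    ext i
    simp only [Set.mem_ofPred_eq]
    constructor
    · intro hi
      by_contra! hlt
      exact (ht i (hts.1.trans hi) hlt).not_gt hi
    · exact fun hi => hts.2.trans_le hi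
  -- Each positive value has the same finite multiplicity in both sequences; values `s ≤ 0` are not
  -- attained. The bijections of the fibres are then glued to a permutation.
  have hfib : ∀ s : ℝ, Nonempty ({k // ranked v k = s} ≃ {i // v i = s}) := by
    intro s
    rcases le_or_gt s 0 with hs | hs
    · have : IsEmpty {k // ranked v k = s} := ⟨fun k => (hrpos k).not_ge (k.2.trans_le hs)⟩
      have : IsEmpty {i // v i = s} := ⟨fun i => (hpos i).not_ge (i.2.trans_le hs)⟩
      exact ⟨Equiv.equivOfIsEmpty _ _⟩
    have hs2 : 0 < s / 2 := by positivity
    have hge : {k | s ≤ ranked v k}.encard = {i | s ≤ v i}.encard := by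
      obtain ⟨t, ⟨h1, h2⟩, h3⟩ := (((hgap v s hs (hfin _ hs2)).and
        (hgap (ranked v) s hs (hrfin _ hs2))).and (Ioo_mem_nhdsLT hs)).exists
      rw [← h1, ← h2, hgt t h3.1.le]
    have hdiff : ∀ w : ℕ → ℝ, {i | w i = s}.encard + {i | s < w i}.encard = {i | s ≤ w i}.encard :=
      fun w => by
        rw [← Set.encard_union_eq]
        · congr 1
          ext i
          simp [le_iff_eq_or_lt, eq_comm]
        · rw [Set.disjoint_left]
          intro i hi hi'
          simp only [Set.mem_ofPred_eq] at hi hi'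
          exact hi'.ne' hi
    have heq : {k | ranked v k = s}.encard = {i | v i = s}.encard := by
      have h := (hdiff (ranked v)).trans (hge.trans (hdiff v).symm)
      rw [hgt s hs.le] at h
      exact (ENat.add_left_injective_of_ne_top (Set.encard_ne_top_iff.2 (hfin s hs))) h
    have hf1 : {k | ranked v k = s}.Finite :=
      (hrfin _ hs2).subset fun k hk => by
        simp only [Set.mem_ofPred_eq] at hk ⊢; linarith
    have hf2 : {i | v i = s}.Finite :=
      (hfin _ hs2).subset fun k hk => by
        simp only [Set.mem_ofPred_eq] at hk ⊢; linarith
    have : Finite {k // ranked v k = s} := hf1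
    have : Finite {i // v i = s} := hf2
    exact Finite.card_eq.1 (congrArg ENat.toNat heq)
  let e := fun s => (hfib s).some
  let σ : Equiv.Perm ℕ := (Equiv.sigmaFiberEquiv (ranked v)).symm.trans
    ((Equiv.sigmaCongrRight e).trans (Equiv.sigmaFiberEquiv v))
  exact ⟨σ, fun k => ((e (ranked v k)) ⟨k, rfl⟩).2.symm⟩

end

end TwoParamDirichlet

namespace TwoParamDirichlet

noncomputable section

variable {S : Type*} [MeasurableSpace S]

/-! ### The law of the random measure -/

/-- The measure `∑ₖ wₖ δ_{ξₖ}`. -/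
def weightedSum (w : ℕ → ℝ) (ξ : ℕ → S) : Measure S :=
  Measure.sum fun k => ENNReal.ofReal (w k) • Measure.dirac (ξ k)

open Classical in
/-- A measure as a probability measure, with default value `ν`. -/
def toProb (ν : ProbabilityMeasure S) (μ : Measure S) : ProbabilityMeasure S :=
  if h : IsProbabilityMeasure μ then ⟨μ, h⟩ else ν

theorem randomMeasure_eq (ν : ProbabilityMeasure S) (p : (ℕ → ℝ) × (ℕ → S)) :
    randomMeasure ν p = toProb ν (weightedSum (ranked (stick p.1)) p.2) := rfl

/-- The random measure with the weights in the order of stick breaking. -/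
def stickMeasure (ν : ProbabilityMeasure S) (p : (ℕ → ℝ) × (ℕ → S)) : ProbabilityMeasure S :=
  toProb ν (weightedSum (stick p.1) p.2)

theorem coe_toProb (ν : ProbabilityMeasure S) {μ : Measure S} (h : IsProbabilityMeasure μ) :
    (toProb ν μ : Measure S) = μ := by
  simp [toProb, h]

theorem measurable_toProb (ν : ProbabilityMeasure S) : Measurable (toProb ν) := by
  classical
  refine measurable_comap_iff.2 ?_
  have : (fun μ : Measure S => (toProb ν μ : Measure S)) =
      fun μ => if μ Set.univ = 1 then μ else (ν : Measure S) := by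
    funext μ
    by_cases h : IsProbabilityMeasure μ
    · rw [coe_toProb ν h, if_pos h.measure_univ]
    · rw [if_neg fun h' => h ⟨h'⟩]
      simp [toProb, h]
  change Measurable fun μ : Measure S => (toProb ν μ : Measure S)
  rw [this]
  exact Measurable.ite (Measure.measurable_coe MeasurableSet.univ (measurableSet_singleton 1))
    measurable_id measurable_const

theorem measurable_weightedSum {X : Type*} [MeasurableSpace X] {w : X → ℕ → ℝ} {ξ : X → ℕ → S}
    (hw : Measurable w) (hξ : Measurable ξ) : Measurable fun x => weightedSum (w x) (ξ x) := by
  refine Measure.measurable_of_measurable_coe _ fun A hA => ?_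
  simp only [weightedSum, Measure.sum_apply _ hA, Measure.smul_apply, Measure.dirac_apply' _ hA,
    smul_eq_mul]
  refine Measurable.tsum fun k => Measurable.mul (by fun_prop) ?_
  exact (measurable_one.indicator hA).comp ((measurable_pi_apply k).comp hξ)

theorem measurable_stick : Measurable stick := by
  refine measurable_pi_lambda _ fun n => ?_
  unfold stick
  fun_prop

theorem measurable_stickMeasure (ν : ProbabilityMeasure S) : Measurable (stickMeasure ν) :=
  (measurable_toProb ν).comp
    (measurable_weightedSum (measurable_stick.comp measurable_fst) measurable_snd)

theorem isProbabilityMeasure_weightedSum {w : ℕ → ℝ} (h0 : ∀ n, 0 ≤ w n) (h1 : HasSum w 1)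
    (ξ : ℕ → S) : IsProbabilityMeasure (weightedSum w ξ) := by
  constructor
  rw [weightedSum, Measure.sum_apply _ MeasurableSet.univ]
  simp only [Measure.smul_apply, measure_univ, smul_eq_mul, mul_one]
  rw [← ENNReal.ofReal_tsum_of_nonneg h0 h1.summable, h1.tsum_eq, ENNReal.ofReal_one]

theorem IsStick.isProbabilityMeasure {U : ℕ → ℝ} (hU : IsStick U) (ξ : ℕ → S) :
    IsProbabilityMeasure (weightedSum (stick U) ξ) :=
  isProbabilityMeasure_weightedSum (stick_nonneg hU.mem) hU.hasSum ξ

theorem IsStick.coe_stickMeasure {U : ℕ → ℝ} (hU : IsStick U) (ν : ProbabilityMeasure S)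
    (ξ : ℕ → S) : (stickMeasure ν (U, ξ) : Measure S) = weightedSum (stick U) ξ :=
  coe_toProb ν (hU.isProbabilityMeasure ξ)

theorem weightedSum_comp_perm (w : ℕ → ℝ) (σ : Equiv.Perm ℕ) (ξ : ℕ → S) :
    weightedSum (w ∘ σ) ξ = weightedSum w (ξ ∘ σ.symm) := by
  refine Eq.trans ?_ (Measure.sum_comp_equiv σ
    fun k => ENNReal.ofReal (w k) • Measure.dirac ((ξ ∘ σ.symm) k))
  simp [weightedSum, Function.comp_def]

theorem measurePreserving_comp_perm (ν : Measure S) [IsProbabilityMeasure ν] (σ : Equiv.Perm ℕ) :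
    MeasurePreserving (fun ξ : ℕ → S => ξ ∘ σ.symm) (Measure.infinitePi fun _ : ℕ => ν)
      (Measure.infinitePi fun _ : ℕ => ν) := by
  refine ⟨by fun_prop, ?_⟩
  have h := Measure.infinitePi_map_piCongrLeft (fun _ : ℕ => ν) σ
  have h2 : (MeasurableEquiv.piCongrLeft (fun _ => S) σ : (ℕ → S) → ℕ → S) =
      fun ξ => ξ ∘ σ.symm := by
    funext ξ i
    obtain ⟨j, rfl⟩ := σ.surjective i
    simp [MeasurableEquiv.coe_piCongrLeft, Equiv.piCongrLeft_apply_apply]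
  rwa [h2] at h

/-- For fixed `U` the ranking is almost surely a permutation of the weights that does not depend on
`ξ`. It can be moved onto the i.i.d. sequence `ξ`, whose law it preserves. In stick-breaking order
each `Uₖ` can be varied on its own. -/
theorem dirichletLaw_eq {θ : ℝ} (hθ : -(1 / 2) < θ) (ν : ProbabilityMeasure S) :
    dirichletLaw (1 / 2) θ ν = ((stickLaw (1 / 2) θ).prod
      (Measure.infinitePi fun _ : ℕ => (ν : Measure S))).map (stickMeasure ν) := by
  have := isProbabilityMeasure_stickLaw hθ
  set P := (stickLaw (1 / 2) θ).prod (Measure.infinitePi fun _ : ℕ => (ν : Measure S))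
  -- the weights computed from the truncated fractions are everywhere in `[0, 1]`
  let c : (ℕ → ℝ) → ℕ → ℝ := fun U i => max 0 (min 1 (U i))
  have hcmem : ∀ U i, c U i ∈ Set.Icc (0 : ℝ) 1 := fun U i =>
    ⟨le_max_left _ _, max_le zero_le_one (min_le_left _ _)⟩
  have hc : Measurable c := by fun_prop
  let R : (ℕ → ℝ) × (ℕ → S) → ProbabilityMeasure S := fun p =>
    toProb ν (weightedSum (ranked (stick (c p.1))) p.2)
  have hR : Measurable R := by
    refine (measurable_toProb ν).comp (measurable_weightedSum ?_ measurable_snd)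
    refine measurable_pi_lambda _ fun k => measurable_ranked
      (measurable_stick.comp (hc.comp measurable_fst)) (fun p => ?_) k
    exact ⟨1, by rintro _ ⟨i, rfl⟩; exact stick_le_one (hcmem p.1) i⟩
  have hcU : ∀ U : ℕ → ℝ, IsStick U → c U = U := fun U hU => by
    funext i
    simp [c, (hU.mem i).1, (hU.mem i).2]
  have hRae : randomMeasure ν =ᵐ[P] R := by
    filter_upwards [Measure.quasiMeasurePreserving_fst.ae (ae_isStick hθ)] with p hp
    simp only [R, hcU _ hp, randomMeasure_eq]
  rw [dirichletLaw, Measure.map_congr hRae]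
  ext A hA
  rw [Measure.map_apply hR hA, Measure.map_apply (measurable_stickMeasure ν) hA,
    Measure.prod_apply (hR hA), Measure.prod_apply (measurable_stickMeasure ν hA)]
  refine lintegral_congr_ae ?_
  filter_upwards [ae_isStick hθ, ae_stickLaw_mem_Ioo hθ] with U hU hU'
  have hpos : ∀ i, 0 < stick U i := fun i =>
    mul_pos (Finset.prod_pos fun j _ => by linarith [(hU' j).2]) (hU' i).1
  obtain ⟨σ, hσ⟩ := exists_perm_ranked hpos (by
    simpa using hU.hasSum.summable.tendsto_atTop_zero)
  have hset : Prod.mk U ⁻¹' (R ⁻¹' A) =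
      (fun ξ : ℕ → S => ξ ∘ σ.symm) ⁻¹' (Prod.mk U ⁻¹' (stickMeasure ν ⁻¹' A)) := by
    ext ξ
    simp only [Set.mem_preimage, R, hcU U hU, stickMeasure]
    rw [← weightedSum_comp_perm, show ranked (stick U) = stick U ∘ σ from funext hσ]
  rw [hset, (measurePreserving_comp_perm (ν : Measure S) σ).measure_preimage
    (measurable_prodMk_left (measurable_stickMeasure ν hA)).nullMeasurableSet]

end

end TwoParamDirichlet

/-! ### Closability of the gradient on all cylinder functions. -/

namespace TwoParamDirichlet

noncomputable section

variable {S : Type*} [MeasurableSpace S]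

/-! ### The centred gradient as an element of an `L²` space -/

/-- The kernel `μ ↦ μ`. -/
def coeKernel (S : Type*) [MeasurableSpace S] : Kernel (ProbabilityMeasure S) S :=
  ⟨fun μ => (μ : Measure S), measurable_subtype_coe⟩

theorem coeKernel_apply (μ : ProbabilityMeasure S) : coeKernel S μ = (μ : Measure S) := rfl

instance : IsMarkovKernel (coeKernel S) := ⟨fun μ => by rw [coeKernel_apply]; infer_instance⟩

/-- The measure `P(dμ) μ(dx)`. -/
def pointLaw (P : Measure (ProbabilityMeasure S)) : Measure (ProbabilityMeasure S × S) :=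
  P ⊗ₘ coeKernel S

instance (P : Measure (ProbabilityMeasure S)) [IsFiniteMeasure P] :
    IsFiniteMeasure (pointLaw P) := by
  unfold pointLaw; infer_instance

theorem lintegral_pointLaw (P : Measure (ProbabilityMeasure S)) [SFinite P]
    {f : ProbabilityMeasure S × S → ℝ≥0∞} (hf : Measurable f) :
    ∫⁻ p, f p ∂pointLaw P = ∫⁻ μ, ∫⁻ x, f (μ, x) ∂(μ : Measure S) ∂P :=
  Measure.lintegral_compProd hf

theorem integral_pointLaw (P : Measure (ProbabilityMeasure S)) [SFinite P]
    {f : ProbabilityMeasure S × S → ℝ} (hf : Integrable f (pointLaw P)) :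
    ∫ p, f p ∂pointLaw P = ∫ μ, ∫ x, f (μ, x) ∂(μ : Measure S) ∂P :=
  Measure.integral_compProd hf

theorem measurable_integral_coe {f : ProbabilityMeasure S × S → ℝ} (hf : Measurable f) :
    Measurable fun μ : ProbabilityMeasure S => ∫ x, f (μ, x) ∂(μ : Measure S) :=
  (hf.stronglyMeasurable.integral_kernel_prod_right' (κ := coeKernel S)).measurable

namespace Cyl

variable (F : Cyl S)

theorem integrable_φ (i : Fin F.d) (μ : Measure S) [IsFiniteMeasure μ] :
    Integrable (F.φ i) μ := by
  obtain ⟨C, hC⟩ := F.φ_bdd i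
  exact Integrable.of_bound (F.φ_meas i).aestronglyMeasurable C (Eventually.of_forall hC)

theorem measurable_pairing : Measurable F.pairing :=
  measurable_pi_lambda _ fun i =>
    measurable_integral_coe ((F.φ_meas i).comp measurable_snd)

theorem continuous_partial (i : Fin F.d) :
    Continuous fun y => fderiv ℝ F.f y (Pi.single i 1) :=
  (F.f_smooth.continuous_fderiv (by simp)).clm_apply continuous_const

theorem measurable_grad : Measurable fun p : ProbabilityMeasure S × S => F.grad p.1 p.2 := by
  unfold grad
  refine Finset.measurable_sum _ fun i _ => Measurable.mul ?_ ((F.φ_meas i).comp measurable_snd)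
  exact (F.continuous_partial i).measurable.comp (F.measurable_pairing.comp measurable_fst)

/-- The pairings of `F` stay in a compact set, on which continuous functions are bounded. -/
theorem exists_bound_comp_pairing {g : (Fin F.d → ℝ) → ℝ} (hg : Continuous g) :
    ∃ C, 0 ≤ C ∧ ∀ μ, |g (F.pairing μ)| ≤ C := by
  choose C hC using F.φ_bdd
  obtain ⟨K, hK⟩ := (isCompact_univ_pi fun i =>
    isCompact_Icc (a := -C i) (b := C i)).exists_bound_of_continuousOn hg.continuousOn
  refine ⟨max K 0, le_max_right _ _, fun μ => (hK _ fun i _ => ?_).trans (le_max_left _ _)⟩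
  have h : ‖∫ x, F.φ i x ∂(μ : Measure S)‖ ≤ C i := by
    simpa using norm_integral_le_of_norm_le_const (μ := (μ : Measure S)) (f := F.φ i)
      (Eventually.of_forall fun x => hC i x)
  exact abs_le.mp h

theorem exists_bound_grad : ∃ C, ∀ μ x, |F.grad μ x| ≤ C := by
  choose A hA0 hA using fun i => F.exists_bound_comp_pairing (F.continuous_partial i)
  choose B hB using F.φ_bdd
  refine ⟨∑ i, A i * B i, fun μ x => (Finset.abs_sum_le_sum_abs _ _).trans
    (Finset.sum_le_sum fun i _ => ?_)⟩
  rw [abs_mul]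
  exact mul_le_mul (hA i μ) (hB i x) (abs_nonneg _) (hA0 i)

theorem integrable_grad (μ : ProbabilityMeasure S) (m : Measure S) [IsFiniteMeasure m] :
    Integrable (F.grad μ) m := by
  obtain ⟨C, hC⟩ := F.exists_bound_grad
  exact Integrable.of_bound (F.measurable_grad.comp measurable_prodMk_left).aestronglyMeasurable C
    (Eventually.of_forall (hC μ))

theorem integral_grad (μ : ProbabilityMeasure S) (m : Measure S) [IsFiniteMeasure m] :
    ∫ x, F.grad μ x ∂m =
      ∑ i, fderiv ℝ F.f (F.pairing μ) (Pi.single i 1) * ∫ x, F.φ i x ∂m := by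
  unfold grad
  rw [integral_finsetSum _ fun i _ => (F.integrable_φ i m).const_mul _]
  simp only [integral_const_mul]

/-- The centred gradient `∇ₓF(μ) - ⟨∇F(μ), μ⟩`. -/
def cgrad (μ : ProbabilityMeasure S) (x : S) : ℝ := F.grad μ x - ∫ y, F.grad μ y ∂(μ : Measure S)

theorem measurable_cgrad : Measurable fun p : ProbabilityMeasure S × S => F.cgrad p.1 p.2 :=
  F.measurable_grad.sub ((measurable_integral_coe F.measurable_grad).comp measurable_fst)

theorem exists_bound_cgrad : ∃ C, ∀ μ x, |F.cgrad μ x| ≤ C := by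
  obtain ⟨C, hC⟩ := F.exists_bound_grad
  refine ⟨C + C, fun μ x => (abs_sub _ _).trans (add_le_add (hC μ x) ?_)⟩
  simpa using norm_integral_le_of_norm_le_const (μ := (μ : Measure S)) (f := F.grad μ)
    (Eventually.of_forall (hC μ))

theorem integrable_cgrad (μ : ProbabilityMeasure S) (m : Measure S) [IsFiniteMeasure m] :
    Integrable (F.cgrad μ) m := (F.integrable_grad μ m).sub (integrable_const _)

theorem memLp_cgrad (P : Measure (ProbabilityMeasure S)) [IsFiniteMeasure P] :
    MemLp (fun p => F.cgrad p.1 p.2) 2 (pointLaw P) :=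
  F.exists_bound_cgrad.elim fun C hC =>
    MemLp.of_bound F.measurable_cgrad.aestronglyMeasurable C
      (Eventually.of_forall fun p => hC p.1 p.2)

theorem covar_grad (G : Cyl S) (μ : ProbabilityMeasure S) :
    covar μ (F.grad μ) (G.grad μ) = ∫ x, F.cgrad μ x * G.cgrad μ x ∂(μ : Measure S) := by
  obtain ⟨C, hC⟩ := F.exists_bound_grad
  have hF := F.integrable_grad μ (μ : Measure S)
  have hG := G.integrable_grad μ (μ : Measure S)
  have hFG : Integrable (fun x => F.grad μ x * G.grad μ x) (μ : Measure S) :=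
    hG.bdd_mul hF.aestronglyMeasurable (Eventually.of_forall (hC μ))
  simp only [covar, cgrad, sub_mul, mul_sub]
  rw [integral_sub, integral_sub, integral_sub]
  · simp only [integral_mul_const, integral_const_mul, integral_const]
    simp
  · exact hF.mul_const _
  · exact integrable_const _
  · exact hFG
  · exact hG.const_mul _
  · exact hFG.sub (hG.const_mul _)
  · exact (hF.mul_const _).sub (integrable_const _)

/-- The centred gradient, normalised so that its inner products are the values of the form. -/
def gradL2 (P : Measure (ProbabilityMeasure S)) [IsFiniteMeasure P] : Lp ℝ 2 (pointLaw P) :=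
  (√2)⁻¹ • (F.memLp_cgrad P).toLp _

theorem gradForm_eq_inner (P : Measure (ProbabilityMeasure S)) [IsFiniteMeasure P] (F G : Cyl S) :
    gradForm P F G = inner ℝ (F.gradL2 P) (G.gradL2 P) := by
  have h : inner ℝ ((F.memLp_cgrad P).toLp _) ((G.memLp_cgrad P).toLp _) =
      ∫ p, F.cgrad p.1 p.2 * G.cgrad p.1 p.2 ∂pointLaw P := by
    rw [L2.inner_def]
    refine integral_congr_ae ?_
    filter_upwards [(F.memLp_cgrad P).coeFn_toLp, (G.memLp_cgrad P).coeFn_toLp] with p h1 h2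
    rw [h1, h2]
    simp [mul_comm]
  have hint : Integrable (fun p : ProbabilityMeasure S × S => F.cgrad p.1 p.2 * G.cgrad p.1 p.2)
      (pointLaw P) := (F.memLp_cgrad P).integrable_mul (G.memLp_cgrad P)
  rw [gradL2, gradL2, real_inner_smul_left, real_inner_smul_right, h, integral_pointLaw P hint,
    gradForm, ← mul_assoc, ← mul_inv, Real.mul_self_sqrt zero_le_two, one_div]
  simp only [F.covar_grad G]

end Cyl

end

end TwoParamDirichlet

namespace TwoParamDirichlet

noncomputable section

/-! ### Closability in one dimension -/

/-- If `Φⱼ → 0` and `Φⱼ' → H` in a weighted `L¹` space on `(0, 1)`, then `H = 0`. -/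
theorem ae_eq_zero_of_tendsto_deriv {Φ Φ' : ℕ → ℝ → ℝ} (hΦ : ∀ j u, HasDerivAt (Φ j) (Φ' j u) u)
    (hΦ' : ∀ j, Continuous (Φ' j)) {H : ℝ → ℝ} (hH : Measurable H) {w : ℝ → ℝ}
    (hw : ContinuousOn w (Set.Ioo 0 1)) (hw0 : ∀ u ∈ Set.Ioo (0 : ℝ) 1, 0 < w u)
    (hlim : Tendsto (fun j => ∫⁻ u in Set.Ioo (0 : ℝ) 1,
      ENNReal.ofReal (w u) * (‖Φ j u‖ₑ + ‖Φ' j u - H u‖ₑ)) atTop (𝓝 0)) :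
    ∀ᵐ u : ℝ, u ∈ Set.Ioo (0 : ℝ) 1 → H u = 0 := by
  have hΦc : ∀ j, Continuous (Φ j) := fun j =>
    continuous_iff_continuousAt.2 fun u => (hΦ j u).continuousAt
  -- On a compact subset of `(0, 1)` the weight is bounded below, so there the convergence holds
  -- without it.
  have hK : ∀ K : Set ℝ, IsCompact K → K ⊆ Set.Ioo 0 1 →
      Tendsto (fun j => ∫⁻ u in K, (‖Φ j u‖ₑ + ‖Φ' j u - H u‖ₑ)) atTop (𝓝 0) := by
    intro K hKc hKs
    obtain ⟨C, hC⟩ := hKc.exists_bound_of_continuousOn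
      ((hw.mono hKs).inv₀ fun u hu => (hw0 u (hKs hu)).ne')
    have h1 : Tendsto (fun j => ENNReal.ofReal C * ∫⁻ u in Set.Ioo (0 : ℝ) 1,
        ENNReal.ofReal (w u) * (‖Φ j u‖ₑ + ‖Φ' j u - H u‖ₑ)) atTop (𝓝 0) := by
      simpa using ENNReal.Tendsto.const_mul hlim (Or.inr ENNReal.ofReal_ne_top)
    refine tendsto_of_tendsto_of_tendsto_of_le_of_le tendsto_const_nhds h1 (fun _ => bot_le)
      fun j => ?_
    rw [← lintegral_const_mul' _ _ ENNReal.ofReal_ne_top]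
    refine (setLIntegral_mono_ae' hKc.measurableSet (Eventually.of_forall fun u hu => ?_)).trans
      (lintegral_mono_set hKs)
    have hwu := hw0 u (hKs hu)
    have h2 : 1 ≤ C * w u := by
      have := hC u hu
      rw [Pi.inv_apply, norm_inv, Real.norm_of_nonneg hwu.le, inv_le_iff_one_le_mul₀ hwu] at this
      exact this
    rw [← mul_assoc, ← ENNReal.ofReal_mul' hwu.le]
    exact le_mul_of_one_le_left bot_le (by simpa using ENNReal.ofReal_le_ofReal h2)
  have hint : ∀ K : Set ℝ, IsCompact K → K ⊆ Set.Ioo 0 1 → IntegrableOn H K := by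
    intro K hKc hKs
    obtain ⟨j, hj⟩ := ((hK K hKc hKs).eventually_lt_const ENNReal.zero_lt_top).exists
    have h1 : IntegrableOn (fun u => Φ' j u - H u) K := by
      refine ⟨((hΦ' j).measurable.sub hH).aestronglyMeasurable, ?_⟩
      exact (lintegral_mono fun u => le_add_self).trans_lt hj
    have h2 : IntegrableOn (Φ' j) K := (hΦ' j).continuousOn.integrableOn_compact hKc
    exact (h2.sub h1).congr (Eventually.of_forall fun u => by simp)
  refine isOpen_Ioo.ae_eq_zero_of_integral_contDiff_smul_eq_zero
    ((locallyIntegrableOn_iff isOpen_Ioo.isLocallyClosed).2 fun K hKs hKc => hint K hKc hKs) ?_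
  intro g hg hgc hgs
  set K := tsupport g
  have hg' : Continuous (deriv g) := hg.continuous_deriv (by simp)
  obtain ⟨A, hA⟩ := hgc.exists_bound_of_continuous hg.continuous
  obtain ⟨B, hB⟩ := hgc.deriv.exists_bound_of_continuous hg'
  set M := max A B
  have hgz : ∀ u, u ∉ K → g u = 0 := fun u hu => image_eq_zero_of_notMem_tsupport hu
  have hgz' : ∀ u, u ∉ K → deriv g u = 0 := fun u hu =>
    image_eq_zero_of_notMem_tsupport fun h => hu (tsupport_deriv_subset h)
  have hgH : Integrable fun u => g u * H u := by
    rw [← integrableOn_iff_integrable_of_support_subset (s := K)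
      (fun u hu => by_contra fun h => hu (by simp [hgz u h]))]
    exact (hint K hgc hgs).continuousOn_mul hg.continuous.continuousOn hgc
  have hbound : ∀ j, ‖∫ u, g u * H u‖ₑ ≤
      ENNReal.ofReal M * ∫⁻ u in K, (‖Φ j u‖ₑ + ‖Φ' j u - H u‖ₑ) := by
    intro j
    have hi1 : Integrable (Φ j * deriv g) :=
      ((hΦc j).mul hg').integrable_of_hasCompactSupport hgc.deriv.mul_left
    have hi2 : Integrable (Φ' j * g) :=
      ((hΦ' j).mul hg.continuous).integrable_of_hasCompactSupport hgc.mul_left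
    have hi3 : Integrable (Φ j * g) :=
      ((hΦc j).mul hg.continuous).integrable_of_hasCompactSupport hgc.mul_left
    have hibp := integral_mul_deriv_eq_deriv_mul_of_integrable (u := Φ j) (v := g)
      (fun u _ => hΦ j u) (fun u _ => (hg.differentiable (by simp) u).hasDerivAt) hi1 hi2 hi3
    -- Integration by parts moves the derivative to the test function; both terms on the right tend
    -- to `0` as `j → ∞`.
    have heq : ∫ u, g u * H u =
        - ∫ u, (Φ j u * deriv g u + (Φ' j u - H u) * g u) := by
      have hi4 : Integrable fun u => (Φ' j u - H u) * g u :=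
        (hi2.sub hgH).congr (Eventually.of_forall fun u => by simp; ring)
      rw [integral_add (f := fun u => Φ j u * deriv g u) hi1 hi4, hibp]
      have : ∫ u, (Φ' j u - H u) * g u = (∫ u, Φ' j u * g u) - ∫ u, g u * H u := by
        rw [← integral_sub (f := fun u => Φ' j u * g u) hi2 hgH]
        exact integral_congr_ae (Eventually.of_forall fun u => by simp; ring)
      rw [this]
      ring
    rw [heq, enorm_neg, ← lintegral_const_mul' _ _ ENNReal.ofReal_ne_top,
      ← lintegral_indicator hgc.measurableSet]
    refine (enorm_integral_le_lintegral_enorm _).trans (lintegral_mono fun u => ?_)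
    by_cases hu : u ∈ K
    · rw [Set.indicator_of_mem hu, mul_add]
      refine (enorm_add_le _ _).trans (add_le_add ?_ ?_)
      · rw [enorm_mul, mul_comm, ← ofReal_norm (deriv g u)]
        gcongr
        exact (hB u).trans (le_max_right _ _)
      · rw [enorm_mul, mul_comm, ← ofReal_norm (g u)]
        gcongr
        exact (hA u).trans (le_max_left _ _)
    · simp [hgz u hu, hgz' u hu]
  have hz : Tendsto (fun j => ENNReal.ofReal M * ∫⁻ u in K, (‖Φ j u‖ₑ + ‖Φ' j u - H u‖ₑ)) atTop
      (𝓝 0) := by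
    simpa using ENNReal.Tendsto.const_mul (hK K hgc hgs) (Or.inr ENNReal.ofReal_ne_top)
  have := ge_of_tendsto' hz hbound
  simpa using this

/-! ### Resampling one break fraction -/

/-- The coordinate `k` is independent of the others, so an independent copy may replace it; this is
checked on finite-dimensional boxes. -/
theorem measurePreserving_update (μ : ℕ → Measure ℝ) [∀ i, IsProbabilityMeasure (μ i)] (k : ℕ) :
    MeasurePreserving (fun p : (ℕ → ℝ) × ℝ => Function.update p.1 k p.2)
      ((Measure.infinitePi μ).prod (μ k)) (Measure.infinitePi μ) := by
  have hmeas : Measurable fun p : (ℕ → ℝ) × ℝ => Function.update p.1 k p.2 := by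
    refine measurable_pi_lambda _ fun i => ?_
    rcases eq_or_ne i k with rfl | h
    · simpa using measurable_snd
    · simp only [Function.update_of_ne h]
      fun_prop
  refine ⟨hmeas, Measure.eq_infinitePi μ fun s t ht => ?_⟩
  rw [Measure.map_apply hmeas (MeasurableSet.pi s.countable_toSet fun i _ => ht i)]
  by_cases hk : k ∈ s
  · have : (fun p : (ℕ → ℝ) × ℝ => Function.update p.1 k p.2) ⁻¹' (Set.pi s t) =
        (Set.pi (s.erase k : Finset ℕ) t) ×ˢ t k := by
      ext ⟨U, u⟩
      simp only [Set.mem_preimage, Set.mem_pi, Set.mem_prod, Finset.mem_coe, Finset.mem_erase]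
      constructor
      · intro h
        refine ⟨fun i hi => ?_, by simpa using h k hk⟩
        simpa [Function.update_of_ne hi.1] using h i hi.2
      · rintro ⟨h1, h2⟩ i hi
        rcases eq_or_ne i k with rfl | hik
        · simpa using h2
        · simpa [Function.update_of_ne hik] using h1 i ⟨hik, hi⟩
    rw [this, Measure.prod_prod, Measure.infinitePi_pi μ fun i _ => ht i,
      Finset.prod_erase_mul _ _ hk]
  · have : (fun p : (ℕ → ℝ) × ℝ => Function.update p.1 k p.2) ⁻¹' (Set.pi s t) =
        (Set.pi s t) ×ˢ Set.univ := by
      ext ⟨U, u⟩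
      simp only [Set.mem_preimage, Set.mem_pi, Set.mem_prod, Finset.mem_coe, Set.mem_univ, and_true]
      refine forall₂_congr fun i hi => ?_
      have : i ≠ k := fun h => hk (h ▸ hi)
      rw [Function.update_of_ne this]
    rw [this, Measure.prod_prod, Measure.infinitePi_pi μ fun i _ => ht i, measure_univ, mul_one]

end

end TwoParamDirichlet

namespace TwoParamDirichlet

noncomputable section

variable {S : Type*} [MeasurableSpace S]

/-! ### Closability along a segment of probability measures -/

/-- Along a segment `m(u) = (1 - u) μ₀ + u μ₁`, with `u` beta distributed: if cylinder functions
tend to `0` and their centred gradients to `G`, then `G(m(u), ·)` has `μ₁`-integral `0`. -/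
theorem integral_eq_zero_of_tendsto_segment {μ₀ μ₁ : ProbabilityMeasure S}
    {m : ℝ → ProbabilityMeasure S} (hm : Measurable m)
    (hseg : ∀ u ∈ Set.Ioo (0 : ℝ) 1, (m u : Measure S) =
      ENNReal.ofReal (1 - u) • (μ₀ : Measure S) + ENNReal.ofReal u • (μ₁ : Measure S))
    {a b : ℝ} (ha : 0 < a) (hb : 0 < b) (F : ℕ → Cyl S)
    {G : ProbabilityMeasure S × S → ℝ} (hG : Measurable G)
    (hlim : Tendsto (fun j => ∫⁻ u, (‖(F j).eval (m u)‖ₑ +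
      ∫⁻ x, ‖(F j).cgrad (m u) x - G (m u, x)‖ₑ ∂(m u : Measure S)) ∂betaMeasure a b)
      atTop (𝓝 0)) :
    ∀ᵐ u ∂betaMeasure a b, ∫ x, G (m u, x) ∂(μ₁ : Measure S) = 0 := by
  let y : ∀ j, ℝ → Fin (F j).d → ℝ := fun j u =>
    (F j).pairing μ₀ + u • ((F j).pairing μ₁ - (F j).pairing μ₀)
  let Φ : ℕ → ℝ → ℝ := fun j u => (F j).f (y j u)
  let Φ' : ℕ → ℝ → ℝ := fun j u =>
    fderiv ℝ (F j).f (y j u) ((F j).pairing μ₁ - (F j).pairing μ₀)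
  -- The factor comes from `μ₁ - m(u) = (1 - u)(μ₁ - μ₀)`: the derivative towards `μ₁ - m(u)` is the
  -- `μ₁`-integral of the centred gradient, while `Φ'` is the derivative towards `μ₁ - μ₀`.
  let H : ℝ → ℝ := fun u => (1 - u)⁻¹ * ∫ x, G (m u, x) ∂(μ₁ : Measure S)
  have hpair : ∀ j, ∀ u ∈ Set.Ioo (0 : ℝ) 1, (F j).pairing (m u) = y j u := by
    intro j u hu
    funext i
    simp only [Cyl.pairing, y, Pi.add_apply, Pi.smul_apply, Pi.sub_apply, smul_eq_mul]
    rw [hseg u hu, integral_add_measure, integral_smul_measure, integral_smul_measure,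
      ENNReal.toReal_ofReal (by linarith [hu.2]), ENNReal.toReal_ofReal hu.1.le, smul_eq_mul,
      smul_eq_mul]
    · ring
    · exact ((F j).integrable_φ i _).smul_measure ENNReal.ofReal_ne_top
    · exact ((F j).integrable_φ i _).smul_measure ENNReal.ofReal_ne_top
  have hyc : ∀ j, Continuous (y j) := fun j => by fun_prop
  have hΦ : ∀ j u, HasDerivAt (Φ j) (Φ' j u) u := by
    intro j u
    have h1 : HasDerivAt (y j) ((F j).pairing μ₁ - (F j).pairing μ₀) u := by
      have h := ((hasDerivAt_id u).smul_const
        ((F j).pairing μ₁ - (F j).pairing μ₀)).const_add ((F j).pairing μ₀)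
      rwa [one_smul] at h
    exact (((F j).f_smooth.differentiable (by simp)) (y j u)).hasFDerivAt.comp_hasDerivAt u h1
  have hΦ' : ∀ j, Continuous (Φ' j) := fun j =>
    (((F j).f_smooth.continuous_fderiv (by simp)).comp (hyc j)).clm_apply continuous_const
  have hgrad : ∀ j, ∀ u ∈ Set.Ioo (0 : ℝ) 1,
      Φ' j u = (1 - u)⁻¹ * ∫ x, (F j).cgrad (m u) x ∂(μ₁ : Measure S) := by
    intro j u hu
    have h1 : (1 - u) ≠ 0 := by linarith [hu.2]
    rw [eq_inv_mul_iff_mul_eq₀ h1]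
    have h2 : ∫ x, (F j).cgrad (m u) x ∂(μ₁ : Measure S) =
        fderiv ℝ (F j).f (y j u) ((F j).pairing μ₁ - y j u) := by
      have h3 : ∀ v : Fin (F j).d → ℝ, fderiv ℝ (F j).f (y j u) v =
          ∑ i, fderiv ℝ (F j).f (y j u) (Pi.single i 1) * v i := by
        intro v
        conv_lhs => rw [← Finset.univ_sum_single v, map_sum]
        refine Finset.sum_congr rfl fun i _ => ?_
        have : Pi.single i (v i) = v i • (Pi.single i 1 : Fin (F j).d → ℝ) := by
          rw [← Pi.single_smul]; simp
        rw [this, map_smul, smul_eq_mul, mul_comm]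
      unfold Cyl.cgrad
      rw [integral_sub ((F j).integrable_grad _ _) (integrable_const _), integral_const,
        (F j).integral_grad, (F j).integral_grad, map_sub, h3, h3 (y j u), hpair j u hu]
      have h4 : ∀ i, ∫ x, (F j).φ i x ∂(m u : Measure S) = y j u i := fun i =>
        congrFun (hpair j u hu) i
      simp only [h4]
      simp [Cyl.pairing]
    rw [h2]
    have h5 : (F j).pairing μ₁ - y j u = (1 - u) • ((F j).pairing μ₁ - (F j).pairing μ₀) := by
      simp only [y]
      module
    rw [h5, map_smul, smul_eq_mul]
  have hH : Measurable H := by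
    refine Measurable.mul (by fun_prop) ?_
    have : Measurable fun p : ℝ × S => G (m p.1, p.2) :=
      hG.comp ((hm.comp measurable_fst).prodMk measurable_snd)
    exact this.stronglyMeasurable.integral_prod_right'.measurable
  -- Since `u μ₁ ≤ m(u)`, the factor `u` pays for passing from `μ₁` to `m(u)`, and `1 - u` cancels
  -- the inverse in `H`.
  have hdiff : ∀ j, ∀ u ∈ Set.Ioo (0 : ℝ) 1, ENNReal.ofReal (u * (1 - u)) * ‖Φ' j u - H u‖ₑ ≤
      ∫⁻ x, ‖(F j).cgrad (m u) x - G (m u, x)‖ₑ ∂(m u : Measure S) := by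
    intro j u hu
    have h1 : 0 < 1 - u := by linarith [hu.2]
    have hmeas : Measurable fun x => (F j).cgrad (m u) x - G (m u, x) :=
      ((F j).measurable_cgrad.comp measurable_prodMk_left).sub (hG.comp measurable_prodMk_left)
    have hle : ENNReal.ofReal u * ∫⁻ x, ‖(F j).cgrad (m u) x - G (m u, x)‖ₑ ∂(μ₁ : Measure S) ≤
        ∫⁻ x, ‖(F j).cgrad (m u) x - G (m u, x)‖ₑ ∂(m u : Measure S) := by
      conv_rhs => rw [hseg u hu]
      rw [lintegral_add_measure, lintegral_smul_measure, lintegral_smul_measure]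
      exact le_add_self
    -- With an infinite error the bound is trivial; otherwise `G(m(u), ·)` is `μ₁`-integrable and
    -- the integrals may be subtracted.
    by_cases htop : ∫⁻ x, ‖(F j).cgrad (m u) x - G (m u, x)‖ₑ ∂(μ₁ : Measure S) = ⊤
    · rw [htop, ENNReal.mul_top (by simpa using hu.1)] at hle
      rw [top_le_iff.1 hle]
      exact le_top
    have hint : Integrable (fun x => (F j).cgrad (m u) x - G (m u, x)) (μ₁ : Measure S) :=
      ⟨hmeas.aestronglyMeasurable, lt_top_iff_ne_top.2 htop⟩
    have hintG : Integrable (fun x => G (m u, x)) (μ₁ : Measure S) :=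
      (((F j).integrable_cgrad (m u) _).sub hint).congr (Eventually.of_forall fun x => by simp)
    have heq : Φ' j u - H u = (1 - u)⁻¹ *
        ∫ x, ((F j).cgrad (m u) x - G (m u, x)) ∂(μ₁ : Measure S) := by
      rw [hgrad j u hu, integral_sub ((F j).integrable_cgrad _ _) hintG, mul_sub]
    refine le_trans ?_ hle
    rw [heq, enorm_mul, ENNReal.ofReal_mul hu.1.le, mul_assoc]
    gcongr
    rw [← mul_assoc, Real.enorm_eq_ofReal (inv_nonneg.2 h1.le), ← ENNReal.ofReal_mul h1.le,
      mul_inv_cancel₀ h1.ne', ENNReal.ofReal_one, one_mul]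
    exact enorm_integral_le_lintegral_enorm _
  -- The beta density times the factor lost in `hdiff`, still positive and continuous on `(0, 1)`.
  let w : ℝ → ℝ := fun u => (1 / beta a b * u ^ (a - 1) * (1 - u) ^ (b - 1)) * (u * (1 - u))
  have hw : ContinuousOn w (Set.Ioo 0 1) := by
    intro u hu
    have h1 : (1 - u) ≠ 0 := by linarith [hu.2]
    have h2 : ContinuousAt (fun u : ℝ => u ^ (a - 1)) u :=
      Real.continuousAt_rpow_const _ _ (Or.inl hu.1.ne')
    have h3 : ContinuousAt (fun u : ℝ => (1 - u) ^ (b - 1)) u :=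
      ContinuousAt.rpow_const (by fun_prop) (Or.inl h1)
    exact (((continuousAt_const.mul h2).mul h3).mul (by fun_prop)).continuousWithinAt
  have hw0 : ∀ u ∈ Set.Ioo (0 : ℝ) 1, 0 < w u := fun u hu => by
    have h := betaPDFReal_pos hu.1 hu.2 ha hb
    rw [betaPDFReal, if_pos ⟨hu.1, hu.2⟩] at h
    exact mul_pos h (mul_pos hu.1 (by linarith [hu.2]))
  have hlim' : Tendsto (fun j => ∫⁻ u in Set.Ioo (0 : ℝ) 1,
      ENNReal.ofReal (w u) * (‖Φ j u‖ₑ + ‖Φ' j u - H u‖ₑ)) atTop (𝓝 0) := by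
    refine tendsto_of_tendsto_of_tendsto_of_le_of_le tendsto_const_nhds hlim (fun _ => bot_le)
      fun j => ?_
    have hpdf : ∀ f : ℝ → ℝ≥0∞, ∫⁻ u, f u ∂betaMeasure a b = ∫⁻ u, betaPDF a b u * f u := by
      intro f
      rw [betaMeasure, lintegral_withDensity_eq_lintegral_mul_non_measurable _
        (measurable_betaPDF a b) (Eventually.of_forall fun u => ENNReal.ofReal_lt_top)]
      rfl
    simp only [hpdf]
    refine (setLIntegral_mono_ae' measurableSet_Ioo (Eventually.of_forall fun u hu => ?_)).trans
      (setLIntegral_le_lintegral (Set.Ioo 0 1) _)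
    have h1 : 0 < 1 - u := by linarith [hu.2]
    have h2 := betaPDFReal_pos hu.1 hu.2 ha hb
    have h3 : ENNReal.ofReal (w u) = betaPDF a b u * ENNReal.ofReal (u * (1 - u)) := by
      rw [betaPDF, ← ENNReal.ofReal_mul h2.le, betaPDFReal, if_pos ⟨hu.1, hu.2⟩]
    rw [h3, mul_assoc, mul_add]
    gcongr
    · have h4 : u * (1 - u) ≤ 1 := by nlinarith [hu.1, hu.2]
      have h5 : (F j).eval (m u) = Φ j u := congrArg (F j).f (hpair j u hu)
      rw [h5]
      refine mul_le_of_le_one_left bot_le ?_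
      simpa using ENNReal.ofReal_le_ofReal h4
    · exact hdiff j u hu
  have hfin := ae_eq_zero_of_tendsto_deriv hΦ hΦ' hH hw hw0 hlim'
  have hac : betaMeasure a b ≪ volume := withDensity_absolutelyContinuous _ _
  filter_upwards [hac.ae_le hfin, ae_betaMeasure_mem_Ioo a b] with u h1 h2
  have h3 : (1 - u)⁻¹ ≠ 0 := inv_ne_zero (by linarith [h2.2])
  exact (mul_eq_zero.1 (h1 h2)).resolve_left h3

end

end TwoParamDirichlet

namespace TwoParamDirichlet

noncomputable section

variable {S : Type*} [MeasurableSpace S]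

/-! ### Closability of the gradient form -/

theorem weightedSum_eq_finset_sum {w : ℕ → ℝ} {n : ℕ} (hw : ∀ i, n ≤ i → w i = 0) (ξ : ℕ → S) :
    weightedSum w ξ = ∑ i ∈ Finset.range n, ENNReal.ofReal (w i) • Measure.dirac (ξ i) := by
  ext A hA
  rw [weightedSum, Measure.sum_apply _ hA, Measure.finsetSum_apply]
  refine tsum_eq_sum fun i hi => ?_
  rw [hw i (by simpa using hi)]
  simp

theorem integral_weightedSum {w : ℕ → ℝ} (h0 : ∀ i, 0 ≤ w i) {n : ℕ}
    (hw : ∀ i, n ≤ i → w i = 0) (ξ : ℕ → S) {f : S → ℝ} (hf : Measurable f) :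
    ∫ x, f x ∂weightedSum w ξ = ∑ i ∈ Finset.range n, w i * f (ξ i) := by
  rw [weightedSum_eq_finset_sum hw, integral_finsetSum_measure]
  · refine Finset.sum_congr rfl fun i _ => ?_
    rw [integral_smul_measure, integral_dirac' _ _ hf.stronglyMeasurable,
      ENNReal.toReal_ofReal (h0 i), smul_eq_mul]
  · intro i _
    exact (integrable_dirac' hf.stronglyMeasurable (by simp)).smul_measure ENNReal.ofReal_ne_top

theorem lintegral_weightedSum (w : ℕ → ℝ) (ξ : ℕ → S) {f : S → ℝ≥0∞} (hf : Measurable f) :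
    ∫⁻ x, f x ∂weightedSum w ξ = ∑' i, ENNReal.ofReal (w i) * f (ξ i) := by
  rw [weightedSum, lintegral_sum_measure]
  refine tsum_congr fun i => ?_
  rw [lintegral_smul_measure, lintegral_dirac' _ hf, smul_eq_mul]

theorem weightedSum_stick_update {U : ℕ → ℝ} (hU : IsStick U) {k : ℕ} (hk : U k < 1) (ξ : ℕ → S)
    {u : ℝ} (hu : u ∈ Set.Icc (0 : ℝ) 1) :
    weightedSum (stick (Function.update U k u)) ξ =
      ENNReal.ofReal (1 - u) • weightedSum (stick (Function.update U k 0)) ξ +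
        ENNReal.ofReal u • weightedSum (stick (Function.update U k 1)) ξ := by
  have h0 := stick_nonneg (hU.update hk (u := 0) (by simp)).mem
  have h1 := stick_nonneg (hU.update hk (u := 1) (by simp)).mem
  have hu' : 0 ≤ 1 - u := by linarith [hu.2]
  ext A hA
  simp only [weightedSum, Measure.add_apply, Measure.smul_apply, Measure.sum_apply _ hA,
    smul_eq_mul]
  rw [← ENNReal.tsum_mul_left, ← ENNReal.tsum_mul_left, ← ENNReal.tsum_add]
  refine tsum_congr fun n => ?_
  rw [stick_update, ENNReal.ofReal_add (mul_nonneg hu' (h0 n)) (mul_nonneg hu.1 (h1 n)),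
    ENNReal.ofReal_mul hu', ENNReal.ofReal_mul hu.1, add_mul, mul_assoc, mul_assoc]

theorem measurable_update_prod (k : ℕ) : Measurable fun q : ((ℕ → ℝ) × (ℕ → S)) × ℝ =>
    (Function.update q.1.1 k q.2, q.1.2) := by
  refine Measurable.prodMk (measurable_pi_lambda _ fun i => ?_) (by fun_prop)
  rcases eq_or_ne i k with rfl | h
  · simpa using measurable_snd
  · simp only [Function.update_of_ne h]
    fun_prop

/-- Passes between statements about almost every `p` and statements about almost every point of the
fibre in which only `Uₖ` varies. -/
theorem lintegral_resample {θ : ℝ} (hθ : -(1 / 2) < θ) (κ : Measure (ℕ → S)) [SFinite κ] (k : ℕ)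
    {A : (ℕ → ℝ) × (ℕ → S) → ℝ≥0∞} (hA : Measurable A) :
    ∫⁻ p, ∫⁻ u, A (Function.update p.1 k u, p.2)
        ∂betaMeasure (1 - 1 / 2) (θ + (k + 1) * (1 / 2)) ∂(stickLaw (1 / 2) θ).prod κ =
      ∫⁻ p, A p ∂(stickLaw (1 / 2) θ).prod κ := by
  have := isProbabilityMeasure_betaMeasure_stick hθ
  set β := betaMeasure (1 - 1 / 2) (θ + (k + 1) * (1 / 2))
  have : IsProbabilityMeasure β := this k
  have hpres := measurePreserving_update
    (fun k : ℕ => betaMeasure (1 - 1 / 2) (θ + (k + 1) * (1 / 2))) k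
  have hA' : Measurable fun q : ((ℕ → ℝ) × (ℕ → S)) × ℝ => A (Function.update q.1.1 k q.2, q.1.2) :=
    hA.comp (measurable_update_prod k)
  rw [lintegral_prod _ hA'.lintegral_prod_right'.aemeasurable,
    lintegral_prod _ hA.aemeasurable]
  have hB : Measurable fun U => ∫⁻ ξ, A (U, ξ) ∂κ := hA.lintegral_prod_right'
  have hB' : Measurable fun p : (ℕ → ℝ) × ℝ => ∫⁻ ξ, A (Function.update p.1 k p.2, ξ) ∂κ :=
    hB.comp hpres.measurable
  change _ = ∫⁻ U, (∫⁻ ξ, A (U, ξ) ∂κ) ∂Measure.infinitePi _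
  rw [← hpres.lintegral_comp hB, lintegral_prod _ hB'.aemeasurable]
  refine lintegral_congr fun U => ?_
  refine lintegral_lintegral_swap (Measurable.aemeasurable ?_)
  exact hA'.comp ((measurable_prodMk_left.comp measurable_fst).prodMk measurable_snd)

theorem tendsto_lintegral_enorm_sub {X : Type*} [MeasurableSpace X] {μ : Measure X}
    [IsFiniteMeasure μ] {f : ℕ → Lp ℝ 2 μ} {g : Lp ℝ 2 μ} (h : Tendsto f atTop (𝓝 g)) :
    Tendsto (fun n => ∫⁻ x, ‖f n x - g x‖ₑ ∂μ) atTop (𝓝 0) := by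
  rw [Lp.tendsto_Lp_iff_tendsto_eLpNorm'] at h
  have hc : μ Set.univ ^ (1 / (1 : ℝ≥0∞).toReal - 1 / (2 : ℝ≥0∞).toReal) ≠ ⊤ :=
    ENNReal.rpow_ne_top_of_nonneg (by norm_num) (measure_ne_top _ _)
  have h2 := ENNReal.Tendsto.mul_const h (Or.inr hc)
  rw [zero_mul] at h2
  refine tendsto_of_tendsto_of_tendsto_of_le_of_le tendsto_const_nhds h2 (fun _ => bot_le)
    fun n => ?_
  refine le_trans (le_of_eq ?_) (eLpNorm_le_eLpNorm_mul_rpow_measure_univ one_le_two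
    ((Lp.aestronglyMeasurable (f n)).sub (Lp.aestronglyMeasurable g)))
  rw [eLpNorm_one_eq_lintegral_enorm]
  rfl

/-- The gradient form of the stick-breaking random measure is closable on the class of all
cylinder functions. -/
theorem gradL2_closable {θ : ℝ} (hθ : -(1 / 2) < θ) (ν : ProbabilityMeasure S)
    {Q : Measure (ProbabilityMeasure S)} [IsFiniteMeasure Q]
    (hQ : Q = ((stickLaw (1 / 2) θ).prod
      (Measure.infinitePi fun _ : ℕ => (ν : Measure S))).map (stickMeasure ν))
    (F : ℕ → Cyl S) (g : Lp ℝ 2 (pointLaw Q))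
    (hF : Tendsto (fun n => (F n).toL2 Q) atTop (𝓝 0))
    (hg : Tendsto (fun n => (F n).gradL2 Q) atTop (𝓝 g)) : g = 0 := by
  have := isProbabilityMeasure_stickLaw hθ
  set κ : Measure (ℕ → S) := Measure.infinitePi fun _ : ℕ => (ν : Measure S)
  set P := (stickLaw (1 / 2) θ).prod κ
  set m := stickMeasure ν
  have hm : Measurable m := measurable_stickMeasure ν
  -- The factor undoes the normalisation in `gradL2`, so that `G` is the limit of the centred
  -- gradients themselves.
  let G : ProbabilityMeasure S × S → ℝ := fun p => √2 * g p
  have hG : Measurable G := (Lp.stronglyMeasurable g).measurable.const_mul _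
  have hlim1 : Tendsto (fun n => ∫⁻ μ, ‖(F n).eval μ‖ₑ ∂Q) atTop (𝓝 0) := by
    refine (tendsto_lintegral_enorm_sub hF).congr fun n => lintegral_congr_ae ?_
    filter_upwards [((F n).memLp Q).coeFn_toLp, Lp.coeFn_zero ℝ 2 Q] with μ h1 h2
    rw [Cyl.toL2, h1, h2]
    simp
  have hlim2 : Tendsto (fun n => ∫⁻ p, ‖(F n).cgrad p.1 p.2 - G p‖ₑ ∂pointLaw Q) atTop (𝓝 0) := by
    have h := ENNReal.Tendsto.const_mul (a := ‖√2‖ₑ) (tendsto_lintegral_enorm_sub hg)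
      (Or.inr enorm_ne_top)
    rw [mul_zero] at h
    refine h.congr fun n => ?_
    rw [← lintegral_const_mul' _ _ enorm_ne_top]
    refine lintegral_congr_ae ?_
    filter_upwards [((F n).memLp_cgrad Q).coeFn_toLp,
      Lp.coeFn_smul (√2)⁻¹ (((F n).memLp_cgrad Q).toLp _)] with p h1 h2
    rw [Cyl.gradL2, h2, Pi.smul_apply, h1, ← enorm_mul, smul_eq_mul, mul_sub, ← mul_assoc,
      mul_inv_cancel₀ (by positivity), one_mul]
  let A : ℕ → (ℕ → ℝ) × (ℕ → S) → ℝ≥0∞ := fun n p =>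
    ‖(F n).eval (m p)‖ₑ + ∫⁻ x, ‖(F n).cgrad (m p) x - G (m p, x)‖ₑ ∂(m p : Measure S)
  have hD : ∀ n, Measurable fun p : ProbabilityMeasure S × S => ‖(F n).cgrad p.1 p.2 - G p‖ₑ :=
    fun n => ((F n).measurable_cgrad.sub hG).enorm
  have hD' : ∀ n, Measurable fun μ : ProbabilityMeasure S =>
      ∫⁻ x, ‖(F n).cgrad μ x - G (μ, x)‖ₑ ∂(μ : Measure S) := fun n =>
    (hD n).lintegral_kernel_prod_right' (κ := coeKernel S)
  have hA : ∀ n, Measurable (A n) := fun n =>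
    ((F n).measurable_eval.comp hm).enorm.add ((hD' n).comp hm)
  have hAlim : Tendsto (fun n => ∫⁻ p, A n p ∂P) atTop (𝓝 0) := by
    have h := hlim1.add hlim2
    rw [add_zero] at h
    refine h.congr fun n => ?_
    rw [lintegral_pointLaw Q (hD n), hQ, lintegral_map (F n).measurable_eval.enorm hm,
      lintegral_map (hD' n) hm, ← lintegral_add_left (f := fun p => ‖(F n).eval (m p)‖ₑ)
        ((F n).measurable_eval.comp hm).enorm]
  -- a subsequence along which the errors are summable
  have hsub : ∀ j : ℕ, ∃ n, ∫⁻ p, A n p ∂P ≤ (2⁻¹ : ℝ≥0∞) ^ j := fun j =>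
    ((hAlim.eventually_le_const (ENNReal.pow_pos (by simp) j))).exists
  choose N hN using hsub
  -- The `k`-th equation of the triangular system. At `Uₖ = 1` the whole remainder goes to `ξₖ` and
  -- later atoms get no mass, so the left side is the integral of `G(m p, ·)` against the end `μ₁`
  -- of the segment.
  have hkey : ∀ k, ∀ᵐ p ∂P, ∑ i ∈ Finset.range k, stick p.1 i * G (m p, p.2 i) +
      remainder p.1 k * G (m p, p.2 k) = 0 := by
    intro k
    set h : (ℕ → ℝ) × (ℕ → S) → ℝ := fun p =>
      ∑ i ∈ Finset.range k, stick p.1 i * G (m p, p.2 i) + remainder p.1 k * G (m p, p.2 k)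
    have hGm : ∀ i, Measurable fun p : (ℕ → ℝ) × (ℕ → S) => G (m p, p.2 i) := fun i =>
      hG.comp (hm.prodMk ((measurable_pi_apply i).comp measurable_snd))
    have hst : ∀ i, Measurable fun p : (ℕ → ℝ) × (ℕ → S) => stick p.1 i := fun i =>
      (measurable_pi_apply i).comp (measurable_stick.comp measurable_fst)
    have hrem : Measurable fun p : (ℕ → ℝ) × (ℕ → S) => remainder p.1 k := by
      unfold remainder; fun_prop
    have hh : Measurable h :=
      (Finset.measurable_sum _ fun i _ => (hst i).mul (hGm i)).add (hrem.mul (hGm k))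
    set a : ℝ := 1 - 1 / 2
    set b : ℝ := θ + (k + 1) * (1 / 2)
    have ha : 0 < a := by norm_num [a]
    have hb : 0 < b := by
      simp only [b]; nlinarith [(Nat.cast_nonneg k : (0 : ℝ) ≤ k)]
    have hprob : IsProbabilityMeasure (betaMeasure a b) := isProbabilityMeasureBeta ha hb
    have hAu : ∀ n, Measurable fun p : (ℕ → ℝ) × (ℕ → S) =>
        ∫⁻ u, A n (Function.update p.1 k u, p.2) ∂betaMeasure a b := fun n =>
      ((hA n).comp (measurable_update_prod k)).lintegral_prod_right'
    -- Summable errors give convergence on almost every fibre, with the same subsequence for all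
    -- fibres.
    have hsum : ∀ᵐ p ∂P, Tendsto (fun j => ∫⁻ u, A (N j) (Function.update p.1 k u, p.2)
        ∂betaMeasure a b) atTop (𝓝 0) := by
      have htop : ∫⁻ p, ∑' j, ∫⁻ u, A (N j) (Function.update p.1 k u, p.2)
          ∂betaMeasure a b ∂P ≠ ⊤ := by
        rw [lintegral_tsum fun j => (hAu (N j)).aemeasurable]
        have hle : ∑' j, ∫⁻ p, ∫⁻ u, A (N j) (Function.update p.1 k u, p.2) ∂betaMeasure a b ∂P ≤
            ∑' j : ℕ, (2⁻¹ : ℝ≥0∞) ^ j := ENNReal.tsum_le_tsum fun j => by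
          rw [lintegral_resample hθ κ k (hA (N j))]
          exact hN j
        refine ne_top_of_le_ne_top ?_ hle
        rw [ENNReal.tsum_geometric]
        simp
      filter_upwards [ae_lt_top (Measurable.tsum fun j => hAu (N j)) htop] with p hp
      exact ENNReal.tendsto_atTop_zero_of_tsum_ne_top hp.ne
    have hzero : ∫⁻ p, ∫⁻ u, ‖h (Function.update p.1 k u, p.2)‖ₑ ∂betaMeasure a b ∂P = 0 := by
      have hhu : Measurable fun p : (ℕ → ℝ) × (ℕ → S) =>
          ∫⁻ u, ‖h (Function.update p.1 k u, p.2)‖ₑ ∂betaMeasure a b :=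
        (hh.enorm.comp (measurable_update_prod k)).lintegral_prod_right'
      rw [lintegral_eq_zero_iff hhu]
      filter_upwards [hsum, Measure.quasiMeasurePreserving_fst.ae (ae_isStick hθ),
        Measure.quasiMeasurePreserving_fst.ae (ae_stickLaw_mem_Ioo hθ)] with p hp hU hU'
      obtain ⟨U, ξ⟩ := p
      simp only at hp hU hU' ⊢
      have hk1 : U k < 1 := (hU' k).2
      have hS : ∀ u ∈ Set.Icc (0 : ℝ) 1, IsStick (Function.update U k u) := fun u hu =>
        hU.update hk1 hu
      let μ₀ : ProbabilityMeasure S := ⟨_, (hS 0 (by simp)).isProbabilityMeasure ξ⟩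
      let μ₁ : ProbabilityMeasure S := ⟨_, (hS 1 (by simp)).isProbabilityMeasure ξ⟩
      have hmu : Measurable fun u : ℝ => m (Function.update U k u, ξ) :=
        hm.comp ((measurable_update_prod k).comp (measurable_prodMk_left (x := (U, ξ))))
      have hres := integral_eq_zero_of_tendsto_segment (μ₀ := μ₀) (μ₁ := μ₁) hmu
        (fun u hu => by
          rw [(hS u (Set.Ioo_subset_Icc_self hu)).coe_stickMeasure ν ξ]
          exact weightedSum_stick_update hU hk1 ξ (Set.Ioo_subset_Icc_self hu))
        ha hb (fun j => F (N j)) hG hp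
      have hint : ∀ u, ∫ x, G (m (Function.update U k u, ξ), x) ∂(μ₁ : Measure S) =
          h (Function.update U k u, ξ) := by
        intro u
        have := integral_weightedSum (stick_nonneg (hS 1 (by simp)).mem) (n := k + 1)
          (fun i hi => by rw [stick_update_of_gt U (by omega)]; simp) ξ
          (f := fun x => G (m (Function.update U k u, ξ), x)) (hG.comp measurable_prodMk_left)
        refine Eq.trans this ?_
        rw [Finset.sum_range_succ]
        simp only [h]
        congr 1
        · refine Finset.sum_congr rfl fun i hi => ?_
          rw [stick_update_of_lt U (Finset.mem_range.1 hi),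
            stick_update_of_lt U (Finset.mem_range.1 hi)]
        · rw [stick_update_self]
          congr 1
          rw [mul_one, remainder, remainder]
          refine Finset.prod_congr rfl fun i hi => ?_
          rw [Function.update_of_ne (Finset.mem_range.1 hi).ne]
      simp only [Pi.zero_apply]
      rw [lintegral_eq_zero_iff (by
        exact hh.enorm.comp ((measurable_update_prod k).comp (measurable_prodMk_left (x := (U, ξ)))))]
      filter_upwards [hres] with u hu
      rw [hint] at hu
      simp [hu]
    rw [lintegral_resample hθ κ k hh.enorm, lintegral_eq_zero_iff hh.enorm] at hzero
    filter_upwards [hzero] with p hp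
    simpa using hp
  -- Forward substitution: the diagonal coefficient `remainder p.1 k` is positive because every
  -- fraction is below `1`.
  have hatoms : ∀ᵐ p ∂P, ∀ k, G (m p, p.2 k) = 0 := by
    filter_upwards [ae_all_iff.2 hkey,
      Measure.quasiMeasurePreserving_fst.ae (ae_stickLaw_mem_Ioo hθ)] with p hp hU k
    induction k using Nat.strong_induction_on with
    | _ k ih =>
      have h := hp k
      rw [Finset.sum_eq_zero fun i hi => by rw [ih i (Finset.mem_range.1 hi), mul_zero],
        zero_add] at h
      refine (mul_eq_zero.1 h).resolve_left (ne_of_gt ?_)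
      exact Finset.prod_pos fun i _ => by linarith [(hU i).2]
  have hG0 : ∫⁻ p, ‖G p‖ₑ ∂pointLaw Q = 0 := by
    have hGk : Measurable fun μ : ProbabilityMeasure S => ∫⁻ x, ‖G (μ, x)‖ₑ ∂(μ : Measure S) :=
      hG.enorm.lintegral_kernel_prod_right' (κ := coeKernel S)
    have hGm : Measurable fun p => ∫⁻ x, ‖G (m p, x)‖ₑ ∂(m p : Measure S) := hGk.comp hm
    rw [lintegral_pointLaw Q hG.enorm, hQ, lintegral_map hGk hm, lintegral_eq_zero_iff hGm]
    filter_upwards [hatoms, Measure.quasiMeasurePreserving_fst.ae (ae_isStick hθ)] with p hp hU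
    simp only [Pi.zero_apply]
    rw [hU.coe_stickMeasure ν p.2, lintegral_weightedSum _ _
      (by exact (hG.comp measurable_prodMk_left).enorm)]
    simp [hp, m]
  rw [lintegral_eq_zero_iff hG.enorm] at hG0
  refine (Lp.eq_zero_iff_ae_eq_zero).2 ?_
  filter_upwards [hG0] with p hp
  have h2 : √2 * g p = 0 := enorm_eq_zero.1 hp
  exact (mul_eq_zero.1 h2).resolve_left (by positivity)

end

end TwoParamDirichlet

/-! ### Density of the functions of finitely many cells in the graph norm. -/

namespace TwoParamDirichlet

noncomputable section

variable {S : Type*} [MeasurableSpace S]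

/-! ### Projected cylinder functions -/

namespace Cyl

theorem toL2_congr (P : Measure (ProbabilityMeasure S)) [IsFiniteMeasure P] {F G : Cyl S}
    (h : ∀ μ, F.eval μ = G.eval μ) : F.toL2 P = G.toL2 P :=
  MemLp.toLp_congr _ _ (Eventually.of_forall h)

theorem gradL2_congr (P : Measure (ProbabilityMeasure S)) [IsFiniteMeasure P] {F G : Cyl S}
    (h : ∀ μ x, F.cgrad μ x = G.cgrad μ x) : F.gradL2 P = G.gradL2 P := by
  unfold gradL2
  rw [MemLp.toLp_congr _ (G.memLp_cgrad P) (Eventually.of_forall fun p => h p.1 p.2)]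

theorem toL2_add (P : Measure (ProbabilityMeasure S)) [IsFiniteMeasure P] {F G H : Cyl S}
    (h : ∀ μ, H.eval μ = F.eval μ + G.eval μ) : H.toL2 P = F.toL2 P + G.toL2 P := by
  unfold toL2
  rw [← MemLp.toLp_add (F.memLp P) (G.memLp P)]
  exact MemLp.toLp_congr _ _ (Eventually.of_forall h)

theorem gradL2_add (P : Measure (ProbabilityMeasure S)) [IsFiniteMeasure P] {F G H : Cyl S}
    (h : ∀ μ x, H.cgrad μ x = F.cgrad μ x + G.cgrad μ x) :
    H.gradL2 P = F.gradL2 P + G.gradL2 P := by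
  unfold gradL2
  rw [← smul_add, ← MemLp.toLp_add (F.memLp_cgrad P) (G.memLp_cgrad P)]
  exact congrArg _ (MemLp.toLp_congr _ _ (Eventually.of_forall fun p => h p.1 p.2))

theorem toL2_smul (P : Measure (ProbabilityMeasure S)) [IsFiniteMeasure P] {F H : Cyl S} {c : ℝ}
    (h : ∀ μ, H.eval μ = c * F.eval μ) : H.toL2 P = c • F.toL2 P := by
  unfold toL2
  rw [← MemLp.toLp_const_smul c (F.memLp P)]
  exact MemLp.toLp_congr _ _ (Eventually.of_forall h)

theorem gradL2_smul (P : Measure (ProbabilityMeasure S)) [IsFiniteMeasure P] {F H : Cyl S} {c : ℝ}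
    (h : ∀ μ x, H.cgrad μ x = c * F.cgrad μ x) : H.gradL2 P = c • F.gradL2 P := by
  unfold gradL2
  rw [smul_comm, ← MemLp.toLp_const_smul c (F.memLp_cgrad P)]
  exact congrArg _ (MemLp.toLp_congr _ _ (Eventually.of_forall fun p => h p.1 p.2))

/-- Centring removes constants. This absorbs the change of gradient caused by eliminating the mass
of the last cell. -/
theorem cgrad_eq_of_grad_add_const {F G : Cyl S} {μ : ProbabilityMeasure S} {c : ℝ}
    (h : ∀ x, F.grad μ x = G.grad μ x + c) (x : S) : F.cgrad μ x = G.cgrad μ x := by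
  unfold cgrad
  simp only [h]
  rw [integral_add (G.integrable_grad μ _) (integrable_const _)]
  simp

end Cyl

namespace DyadicPartition

variable {ν : Measure S} (D : DyadicPartition ν)

/-- The masses of the cells of generation `k` except the last. -/
def cellMass (k : ℕ) (μ : ProbabilityMeasure S) : Fin (2 ^ k - 1) → ℝ :=
  (D.cyl k 0 contDiff_const).pairing μ

theorem grad_cyl (k : ℕ) (f : (Fin (2 ^ k - 1) → ℝ) → ℝ) (hf : ContDiff ℝ ∞ f)
    (μ : ProbabilityMeasure S) (x : S) :
    (D.cyl k f hf).grad μ x = ∑ i : Fin (2 ^ k - 1), fderiv ℝ f (D.cellMass k μ) (Pi.single i 1) *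
      (D.B k ⟨i, by have := i.2; omega⟩).indicator (fun _ => 1) x := rfl

theorem cgrad_cyl_add (k : ℕ) {f g : (Fin (2 ^ k - 1) → ℝ) → ℝ} (hf : ContDiff ℝ ∞ f)
    (hg : ContDiff ℝ ∞ g) (μ : ProbabilityMeasure S) (x : S) :
    (D.cyl k (f + g) (hf.add hg)).cgrad μ x =
      (D.cyl k f hf).cgrad μ x + (D.cyl k g hg).cgrad μ x := by
  have h : ∀ x, (D.cyl k (f + g) (hf.add hg)).grad μ x =
      (D.cyl k f hf).grad μ x + (D.cyl k g hg).grad μ x := fun x => by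
    simp only [grad_cyl]
    rw [fderiv_add (hf.differentiable (by simp) _) (hg.differentiable (by simp) _),
      ← Finset.sum_add_distrib]
    simp [add_mul]
  unfold Cyl.cgrad
  simp only [h]
  rw [integral_add ((D.cyl k f hf).integrable_grad μ _) ((D.cyl k g hg).integrable_grad μ _)]
  ring

theorem cgrad_cyl_smul (k : ℕ) (c : ℝ) {f : (Fin (2 ^ k - 1) → ℝ) → ℝ} (hf : ContDiff ℝ ∞ f)
    (μ : ProbabilityMeasure S) (x : S) :
    (D.cyl k (c • f) (contDiff_const.smul hf)).cgrad μ x = c * (D.cyl k f hf).cgrad μ x := by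
  have h : ∀ x, (D.cyl k (c • f) (contDiff_const.smul hf)).grad μ x =
      c * (D.cyl k f hf).grad μ x := fun x => by
    simp only [grad_cyl]
    rw [fderiv_const_smul (hf.differentiable (by simp) _), Finset.mul_sum]
    simp [mul_assoc]
  unfold Cyl.cgrad
  simp only [h]
  rw [integral_const_mul]
  ring

variable (P : Measure (ProbabilityMeasure S)) [IsFiniteMeasure P]

/-- The graph of the gradient on the functions of the cells of generation `k`. -/
def graph (k : ℕ) : Submodule ℝ (WithLp 2 (Lp ℝ 2 P × Lp ℝ 2 (pointLaw P))) where
  carrier := {w | ∃ F ∈ D.cylSet k, WithLp.toLp 2 (F.toL2 P, F.gradL2 P) = w}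
  add_mem' := by
    rintro _ _ ⟨_, ⟨f, hf, rfl⟩, rfl⟩ ⟨_, ⟨g, hg, rfl⟩, rfl⟩
    refine ⟨_, ⟨f + g, hf.add hg, rfl⟩, ?_⟩
    rw [Cyl.toL2_add P (F := D.cyl k f hf) (G := D.cyl k g hg) fun μ => rfl,
      Cyl.gradL2_add P (D.cgrad_cyl_add k hf hg)]
    rfl
  zero_mem' := by
    refine ⟨_, ⟨(0 : ℝ) • 0, contDiff_const.smul contDiff_const, rfl⟩, ?_⟩
    rw [Cyl.toL2_smul P (F := D.cyl k 0 contDiff_const) (c := 0) fun μ => rfl,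
      Cyl.gradL2_smul P (D.cgrad_cyl_smul k 0 (f := 0) contDiff_const), zero_smul, zero_smul]
    rfl
  smul_mem' := by
    rintro c _ ⟨_, ⟨f, hf, rfl⟩, rfl⟩
    refine ⟨_, ⟨c • f, contDiff_const.smul hf, rfl⟩, ?_⟩
    rw [Cyl.toL2_smul P (F := D.cyl k f hf) (c := c) fun μ => rfl,
      Cyl.gradL2_smul P (D.cgrad_cyl_smul k c hf)]
    rfl

theorem mem_graph {k : ℕ} {w : WithLp 2 (Lp ℝ 2 P × Lp ℝ 2 (pointLaw P))} :
    w ∈ D.graph P k ↔ ∃ F ∈ D.cylSet k, WithLp.toLp 2 (F.toL2 P, F.gradL2 P) = w := Iff.rfl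

/-- The function `φ` is constant on each cell of generation `k`. -/
def IsStep (k : ℕ) (φ : S → ℝ) : Prop :=
  ∃ a : Fin (2 ^ k) → ℝ, ∀ j, ∀ x ∈ D.B k j, φ x = a j

theorem exists_mem_cell (k : ℕ) (x : S) : ∃ j, x ∈ D.B k j :=
  Set.mem_iUnion.1 (D.cover k ▸ Set.mem_univ x)

theorem cell_unique {k : ℕ} {i j : Fin (2 ^ k)} {x : S} (hi : x ∈ D.B k i) (hj : x ∈ D.B k j) :
    i = j :=
  by_contra fun h => Set.disjoint_left.1 (D.disj k h) hi hj

/-- A cylinder function whose arguments are pairings with step functions is a function of the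
masses of all the cells but the last. -/
theorem mem_graph_of_isStep {k : ℕ} (F : Cyl S) (hF : ∀ i, D.IsStep k (F.φ i)) :
    WithLp.toLp 2 (F.toL2 P, F.gradL2 P) ∈ D.graph P k := by
  choose a ha using hF
  have hpos : 0 < 2 ^ k := by positivity
  let last : Fin (2 ^ k) := ⟨2 ^ k - 1, by omega⟩
  let e : Fin (2 ^ k - 1) → Fin (2 ^ k) := fun l => ⟨l, by have := l.2; omega⟩
  -- The total mass is `1`, so `∑ⱼ aⱼ μ(Bⱼ) = a_last + ∑ₗ (aₗ - a_last) μ(Bₗ)`, where `l` omits the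
  -- last cell.
  let A : (Fin (2 ^ k - 1) → ℝ) →L[ℝ] (Fin F.d → ℝ) := LinearMap.toContinuousLinearMap
    (Matrix.toLin' (Matrix.of fun i l => a i (e l) - a i last))
  have hA : ∀ y i, A y i = ∑ l, (a i (e l) - a i last) * y l := fun y i => rfl
  let c : Fin F.d → ℝ := fun i => a i last
  let f : (Fin (2 ^ k - 1) → ℝ) → ℝ := fun y => F.f (A y + c)
  have hf : ContDiff ℝ ∞ f := F.f_smooth.comp (A.contDiff.add contDiff_const)
  set G := D.cyl k f hf
  let χ : Fin (2 ^ k - 1) → S → ℝ := fun l => (D.B k (e l)).indicator fun _ => 1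
  have hχ : ∀ (μ : ProbabilityMeasure S) l, Integrable (χ l) (μ : Measure S) := fun μ l =>
    G.integrable_φ l _
  have hmass : ∀ μ l, D.cellMass k μ l = ∫ x, χ l x ∂(μ : Measure S) := fun _ _ => rfl
  have hφ : ∀ i x, F.φ i x = ∑ l, (a i (e l) - a i last) * χ l x + c i := by
    intro i x
    obtain ⟨j, hj⟩ := D.exists_mem_cell k x
    rw [ha i j x hj]
    have hind : ∀ l, χ l x = if e l = j then 1 else 0 := fun l => by
      simp only [χ]
      by_cases h : e l = j
      · rw [if_pos h, Set.indicator_of_mem (h ▸ hj)]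
      · rw [if_neg h, Set.indicator_of_notMem fun hx => h (D.cell_unique hx hj)]
    simp only [hind, mul_ite, mul_one, mul_zero]
    by_cases hjl : (j : ℕ) < 2 ^ k - 1
    · have he : ∀ l, e l = j ↔ l = ⟨j, hjl⟩ := fun l => by
        simp [e, Fin.ext_iff]
      have : e ⟨j, hjl⟩ = j := rfl
      simp [he, c, this]
    · have hjlast : j = last := Fin.ext (by have := j.2; simp only [last]; omega)
      have he : ∀ l, e l ≠ j := fun l h => hjl (by rw [← h]; exact l.2)
      simp only [if_neg (he _), Finset.sum_const_zero, zero_add]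
      rw [hjlast]
  have hpair : ∀ μ, F.pairing μ = A (D.cellMass k μ) + c := by
    intro μ
    funext i
    simp only [Pi.add_apply, hA, hmass, Cyl.pairing, hφ]
    rw [integral_add, integral_finsetSum]
    · simp [integral_const_mul]
    · exact fun l _ => (hχ μ l).const_mul _
    · exact integrable_finsetSum _ fun l _ => (hχ μ l).const_mul _
    · exact integrable_const _
  refine ⟨G, ⟨f, hf, rfl⟩, ?_⟩
  have heval : ∀ μ, G.eval μ = F.eval μ := fun μ => by
    change F.f (A (D.cellMass k μ) + c) = F.f (F.pairing μ)
    rw [hpair]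
  have hgrad : ∀ μ x, F.grad μ x = G.grad μ x +
      ∑ i, fderiv ℝ F.f (F.pairing μ) (Pi.single i 1) * c i := by
    intro μ x
    have hder : ∀ l, fderiv ℝ f (D.cellMass k μ) (Pi.single l 1) =
        ∑ i, fderiv ℝ F.f (F.pairing μ) (Pi.single i 1) * (a i (e l) - a i last) := by
      intro l
      have h1 : HasFDerivAt f ((fderiv ℝ F.f (F.pairing μ)).comp A) (D.cellMass k μ) := by
        have h2 := (F.f_smooth.differentiable (by simp) (F.pairing μ)).hasFDerivAt
        rw [hpair] at h2 ⊢
        exact h2.comp (D.cellMass k μ) (A.hasFDerivAt.add_const c)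
      rw [h1.fderiv, ContinuousLinearMap.comp_apply]
      have h3 : A (Pi.single l 1) = ∑ i, (a i (e l) - a i last) • (Pi.single i 1 : Fin F.d → ℝ) := by
        funext i
        rw [hA]
        simp [Pi.single_apply, Finset.sum_apply]
      rw [h3, map_sum]
      simp [mul_comm]
    change ∑ i, fderiv ℝ F.f (F.pairing μ) (Pi.single i 1) * F.φ i x =
      ∑ l, fderiv ℝ f (D.cellMass k μ) (Pi.single l 1) * χ l x + _
    simp only [hder, hφ, mul_add, Finset.sum_add_distrib, Finset.mul_sum, Finset.sum_mul]
    rw [Finset.sum_comm]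
    simp only [mul_assoc]
  rw [Cyl.toL2_congr P heval, Cyl.gradL2_congr P fun μ x =>
    (Cyl.cgrad_eq_of_grad_add_const (hgrad μ) x).symm]

theorem cell_subset_parent (k : ℕ) (j : Fin (2 ^ (k + 1))) :
    D.B (k + 1) j ⊆ D.B k ⟨j / 2, by have := j.2; have := pow_succ 2 k; omega⟩ := by
  rw [D.split k]
  rcases Nat.even_or_odd' (j : ℕ) with ⟨c, hc | hc⟩
  · refine Set.subset_union_of_subset_left (le_of_eq ?_) _
    congr 1
    exact Fin.ext (by simp only; omega)
  · refine Set.subset_union_of_subset_right (le_of_eq ?_) _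
    congr 1
    exact Fin.ext (by simp only; omega)

/-- A cell is a union of cells of the next generation, so its indicator is a step function there,
and `mem_graph_of_isStep` applies. -/
theorem monotone_graph : Monotone (D.graph P) := by
  refine monotone_nat_of_le_succ fun k => ?_
  rintro _ ⟨_, ⟨f, hf, rfl⟩, rfl⟩
  refine D.mem_graph_of_isStep P _ fun i => ?_
  classical
  refine ⟨fun j => if (i : ℕ) = j / 2 then 1 else 0, fun j x hx => ?_⟩
  have hpar := D.cell_subset_parent k j hx
  have hi : (i : ℕ) < 2 ^ k - 1 := i.2
  change (D.B k ⟨i, by omega⟩).indicator (fun _ => (1 : ℝ)) x = if (i : ℕ) = j / 2 then 1 else 0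
  by_cases h : (i : ℕ) = j / 2
  · rw [if_pos h, Set.indicator_of_mem]
    convert hpar
  · rw [if_neg h, Set.indicator_of_notMem]
    intro hx'
    exact h (congrArg Fin.val (D.cell_unique hx' hpar))

end DyadicPartition

end

end TwoParamDirichlet

namespace TwoParamDirichlet

noncomputable section

variable {S : Type*} [MeasurableSpace S]

/-! ### Approximation by step functions -/

theorem tendsto_toLp_of_bounded {X : Type*} [MeasurableSpace X] {μ : Measure X} [IsFiniteMeasure μ]
    {f : ℕ → X → ℝ} {g : X → ℝ} (hf : ∀ n, MemLp (f n) 2 μ) (hg : MemLp g 2 μ) {C : ℝ}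
    (hfC : ∀ n x, |f n x| ≤ C) (hgC : ∀ x, |g x| ≤ C)
    (hlim : ∀ᵐ x ∂μ, Tendsto (fun n => f n x) atTop (𝓝 (g x))) :
    Tendsto (fun n => (hf n).toLp (f n)) atTop (𝓝 (hg.toLp g)) := by
  rw [Lp.tendsto_Lp_iff_tendsto_eLpNorm'']
  have hpow : ∀ n, eLpNorm (f n - g) 2 μ = (∫⁻ x, ‖f n x - g x‖ₑ ^ (2 : ℝ) ∂μ) ^ (1 / 2 : ℝ) := by
    intro n
    rw [eLpNorm_eq_lintegral_rpow_enorm_toReal two_ne_zero ENNReal.ofNat_ne_top]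
    simp
  simp only [hpow]
  have h0 : Tendsto (fun n => ∫⁻ x, ‖f n x - g x‖ₑ ^ (2 : ℝ) ∂μ) atTop (𝓝 (∫⁻ _, 0 ∂μ)) := by
    refine tendsto_lintegral_of_dominated_convergence' (fun _ => ENNReal.ofReal (C + C) ^ (2 : ℝ))
      (fun n => ((hf n).1.sub hg.1).enorm.pow_const _) (fun n => Eventually.of_forall fun x => ?_)
      ?_ ?_
    · refine ENNReal.rpow_le_rpow ?_ zero_le_two
      rw [← ofReal_norm]
      exact ENNReal.ofReal_le_ofReal ((abs_sub _ _).trans (add_le_add (hfC n x) (hgC x)))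
    · rw [lintegral_const]
      exact ENNReal.mul_ne_top (ENNReal.rpow_ne_top_of_nonneg zero_le_two ENNReal.ofReal_ne_top)
        (measure_ne_top _ _)
    · filter_upwards [hlim] with x hx
      have h1 : Tendsto (fun n => ‖f n x - g x‖ₑ) atTop (𝓝 0) := by
        have := (hx.sub_const (g x)).enorm
        simpa using this
      simpa using h1.ennrpow_const 2
  rw [lintegral_zero] at h0
  simpa using h0.ennrpow_const (1 / 2)

namespace DyadicPartition

variable {ν : Measure S} (D : DyadicPartition ν)

/-- The index of the cell of generation `k` which contains `x`. -/
def index (k : ℕ) (x : S) : Fin (2 ^ k) := (D.exists_mem_cell k x).choose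

theorem mem_index (k : ℕ) (x : S) : x ∈ D.B k (D.index k x) := (D.exists_mem_cell k x).choose_spec

theorem preimage_index (k : ℕ) (j : Fin (2 ^ k)) : D.index k ⁻¹' {j} = D.B k j := by
  ext x
  simp only [Set.mem_preimage, Set.mem_singleton_iff]
  exact ⟨fun h => h ▸ D.mem_index k x, fun h => D.cell_unique (D.mem_index k x) h⟩

theorem measurable_index (k : ℕ) : Measurable (D.index k) :=
  measurable_to_countable' fun j => by rw [D.preimage_index]; exact D.meas k j

theorem index_succ (k : ℕ) (x : S) : (D.index k x : ℕ) = D.index (k + 1) x / 2 :=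
  congrArg Fin.val (D.cell_unique (D.mem_index k x)
    (D.cell_subset_parent k _ (D.mem_index (k + 1) x)))

/-- The filtration generated by the partitions. -/
def filtration : Filtration ℕ (inferInstance : MeasurableSpace S) where
  seq k := MeasurableSpace.comap (D.index k) ⊤
  mono' := by
    refine monotone_nat_of_le_succ fun k => ?_
    let r : Fin (2 ^ (k + 1)) → Fin (2 ^ k) := fun j =>
      ⟨j / 2, by have := j.2; have := pow_succ 2 k; omega⟩
    have h : D.index k = r ∘ D.index (k + 1) := by
      funext x
      exact Fin.ext (D.index_succ k x)
    rw [h, ← MeasurableSpace.comap_comp]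
    exact MeasurableSpace.comap_mono le_top
  le' k := (D.measurable_index k).comap_le

/-- Events of generation `k` are unions of cells, so `φ` cannot separate two points of a cell. Cells
have positive mass, hence contain a point at which to read the value. -/
theorem isStep_of_stronglyMeasurable [IsProbabilityMeasure ν] {k : ℕ} {φ : S → ℝ}
    (hφ : StronglyMeasurable[D.filtration k] φ) : D.IsStep k φ := by
  have hne : ∀ j, (D.B k j).Nonempty := fun j =>
    nonempty_of_measure_ne_zero (μ := ν) (by rw [D.mass]; simp)
  refine ⟨fun j => φ (hne j).choose, fun j x hx => ?_⟩
  have hm : MeasurableSet[D.filtration k] (φ ⁻¹' {φ x}) :=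
    hφ.measurable (measurableSet_singleton _)
  obtain ⟨s, -, hs⟩ := hm
  have hx' : x ∈ D.index k ⁻¹' s := by rw [hs]; rfl
  have hidx : D.index k (hne j).choose = D.index k x :=
    (D.cell_unique (D.mem_index k _) (hne j).choose_spec).trans
      (D.cell_unique (D.mem_index k x) hx).symm
  have hy : (hne j).choose ∈ φ ⁻¹' {φ x} := by
    rw [← hs, Set.mem_preimage, hidx]
    exact hx'
  exact (Set.mem_singleton_iff.1 hy).symm

/-- A Borel set agrees up to a null set with one generated by the cells, so both functions have the
same integral over every Borel set. -/
theorem condExp_iSup_filtration [IsProbabilityMeasure ν] (hD : D.Generates) {φ : S → ℝ}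
    (hφ : Integrable φ ν) : ν[φ | ⨆ n, D.filtration n] =ᵐ[ν] φ := by
  have hle : (⨆ n, D.filtration n) ≤ (inferInstance : MeasurableSpace S) :=
    iSup_le fun n => D.filtration.le n
  have hgen : MeasurableSpace.generateFrom {s | ∃ k j, s = D.B k j} ≤ ⨆ n, D.filtration n := by
    refine MeasurableSpace.generateFrom_le ?_
    rintro _ ⟨k, j, rfl⟩
    exact le_iSup (fun n => D.filtration n) k _ ⟨{j}, trivial, D.preimage_index k j⟩
  refine integrable_condExp.ae_eq_of_forall_setIntegral_eq _ _ hφ fun A hA _ => ?_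
  obtain ⟨A', hA', hAA'⟩ := hD A hA
  rw [setIntegral_congr_set hAA', setIntegral_congr_set hAA',
    setIntegral_condExp hle hφ (hgen _ hA')]

/-- Lévy's upward theorem for the conditional expectations on the cells. Truncation to `[-C, C]`
makes the bound hold everywhere instead of almost everywhere, and keeps step functions step
functions. -/
theorem exists_isStep_tendsto [IsProbabilityMeasure ν] (hD : D.Generates) {φ : S → ℝ}
    (hφ : Measurable φ) {C : ℝ} (hC : ∀ x, |φ x| ≤ C) :
    ∃ ψ : ℕ → S → ℝ, (∀ n, Measurable (ψ n)) ∧ (∀ n x, |ψ n x| ≤ C) ∧ (∀ n, D.IsStep n (ψ n)) ∧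
      ∀ᵐ x ∂ν, Tendsto (fun n => ψ n x) atTop (𝓝 (φ x)) := by
  have hint : Integrable φ ν :=
    Integrable.of_bound hφ.aestronglyMeasurable C (Eventually.of_forall hC)
  let t : ℝ → ℝ := fun y => max (-C) (min C y)
  have ht : Continuous t := by fun_prop
  refine ⟨fun n x => t ((ν[φ | D.filtration n]) x), fun n => ?_, fun n x => ?_, fun n => ?_, ?_⟩
  · exact ht.measurable.comp (stronglyMeasurable_condExp.mono (D.filtration.le n)).measurable
  · have hC0 : 0 ≤ C := (abs_nonneg _).trans (hC x)
    exact abs_le.2 ⟨le_max_left _ _, max_le (by linarith) (min_le_left _ _)⟩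
  · exact D.isStep_of_stronglyMeasurable (ht.comp_stronglyMeasurable stronglyMeasurable_condExp)
  · filter_upwards [tendsto_ae_condExp (ℱ := D.filtration) (μ := ν) φ,
      D.condExp_iSup_filtration hD hint] with x h1 h2
    rw [h2] at h1
    have h3 : t (φ x) = φ x := by
      have := abs_le.1 (hC x)
      simp [t, this.1, this.2]
    rw [← h3]
    exact (ht.tendsto _).comp h1

end DyadicPartition

/-- The random measure charges only the points `ξᵢ`, which have law `ν` and so almost surely all
avoid `N`. This carries convergence `ν`-a.e. over to almost every `μ`. -/
theorem ae_dirichletLaw_null {θ : ℝ} (hθ : -(1 / 2) < θ) (ν : ProbabilityMeasure S) {N : Set S}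
    (hN : MeasurableSet N) (h0 : (ν : Measure S) N = 0) :
    ∀ᵐ μ : ProbabilityMeasure S ∂dirichletLaw (1 / 2) θ ν, (μ : Measure S) N = 0 := by
  have := isProbabilityMeasure_stickLaw hθ
  have hset : MeasurableSet {μ : ProbabilityMeasure S | (μ : Measure S) N = 0} :=
    ((Measure.measurable_coe hN).comp measurable_subtype_coe) (measurableSet_singleton 0)
  rw [dirichletLaw_eq hθ, ae_map_iff (measurable_stickMeasure ν).aemeasurable hset]
  have hξ : ∀ᵐ ξ ∂(Measure.infinitePi fun _ : ℕ => (ν : Measure S)), ∀ i, ξ i ∉ N := by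
    rw [ae_all_iff]
    intro i
    exact (measurePreserving_eval_infinitePi
      (fun _ : ℕ => (ν : Measure S)) i).quasiMeasurePreserving.ae (measure_eq_zero_iff_ae_notMem.1 h0)
  filter_upwards [Measure.quasiMeasurePreserving_fst.ae (ae_isStick hθ),
    Measure.quasiMeasurePreserving_snd.ae hξ] with p hU hp
  rw [hU.coe_stickMeasure ν p.2, weightedSum, Measure.sum_apply _ hN]
  simp [Measure.dirac_apply' _ hN, hp]

/-- The cylinder function with the test functions of `F` replaced by `ψ`. -/
def Cyl.withTest (F : Cyl S) (ψ : Fin F.d → S → ℝ) (hm : ∀ i, Measurable (ψ i))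
    (hb : ∀ i, ∃ C, ∀ x, |ψ i x| ≤ C) : Cyl S :=
  { F with
    φ := ψ
    φ_meas := hm
    φ_bdd := hb }

/-- All pairings stay in one compact box, on which `f` and its partial derivatives are bounded.
Dominated convergence then applies under `μ`, for the pairings and the centring, and again under `Q`
and `pointLaw Q`. -/
theorem Cyl.tendsto_graph (Q : Measure (ProbabilityMeasure S)) [IsFiniteMeasure Q] (F : Cyl S)
    {C : Fin F.d → ℝ} (hC : ∀ i x, |F.φ i x| ≤ C i) {ψ : Fin F.d → ℕ → S → ℝ}
    (hψm : ∀ i n, Measurable (ψ i n)) (hψC : ∀ i n x, |ψ i n x| ≤ C i) {N : Set S}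
    (hNm : MeasurableSet N) (hQN : ∀ᵐ μ : ProbabilityMeasure S ∂Q, (μ : Measure S) N = 0)
    (hconv : ∀ x ∉ N, ∀ i, Tendsto (fun n => ψ i n x) atTop (𝓝 (F.φ i x))) {Fn : ℕ → Cyl S}
    (hFn : Fn = fun n => F.withTest (fun i => ψ i n) (fun i => hψm i n)
      fun i => ⟨C i, hψC i n⟩) :
    Tendsto (fun n => WithLp.toLp 2 ((Fn n).toL2 Q, (Fn n).gradL2 Q)) atTop
      (𝓝 (WithLp.toLp 2 (F.toL2 Q, F.gradL2 Q))) := by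
  subst hFn
  set Fn : ℕ → Cyl S := fun n => F.withTest (fun i => ψ i n) (fun i => hψm i n)
    fun i => ⟨C i, hψC i n⟩
  -- uniform bounds
  obtain ⟨box, hbox', hbox⟩ : ∃ box : Set (Fin F.d → ℝ),
      (Set.univ.pi fun i => Set.Icc (-C i) (C i)) = box ∧ IsCompact box :=
    ⟨_, rfl, isCompact_univ_pi fun i => isCompact_Icc⟩
  have hmem : ∀ (φ : Fin F.d → S → ℝ), (∀ i x, |φ i x| ≤ C i) → ∀ μ : ProbabilityMeasure S,
      (fun i => ∫ x, φ i x ∂(μ : Measure S)) ∈ box := by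
    intro φ hφ μ
    rw [← hbox']
    intro i _
    have h : ‖∫ x, φ i x ∂(μ : Measure S)‖ ≤ C i := by
      simpa using norm_integral_le_of_norm_le_const (μ := (μ : Measure S)) (f := φ i)
        (Eventually.of_forall fun x => hφ i x)
    exact abs_le.mp h
  have hmemn : ∀ n μ, (Fn n).pairing μ ∈ box := fun n => hmem _ fun i => hψC i n
  have hmemF : ∀ μ, F.pairing μ ∈ box := hmem _ hC
  have hpair : ∀ᵐ μ ∂Q, Tendsto (fun n => (Fn n).pairing μ) atTop (𝓝 (F.pairing μ)) := by
    filter_upwards [hQN] with μ hμ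
    refine tendsto_pi_nhds.2 fun i => ?_
    refine tendsto_integral_of_dominated_convergence (fun _ => C i)
      (fun n => (hψm i n).aestronglyMeasurable) (integrable_const _)
      (fun n => Eventually.of_forall (hψC i n)) ?_
    filter_upwards [measure_eq_zero_iff_ae_notMem.1 hμ] with x hx using hconv x hx i
  -- convergence of the functions
  have hJ : Tendsto (fun n => (Fn n).toL2 Q) atTop (𝓝 (F.toL2 Q)) := by
    obtain ⟨K, hK⟩ := hbox.exists_bound_of_continuousOn F.f_smooth.continuous.continuousOn
    refine tendsto_toLp_of_bounded _ _ (fun n μ => hK _ (hmemn n μ)) (fun μ => hK _ (hmemF μ)) ?_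
    filter_upwards [hpair] with μ hμ
    exact (F.f_smooth.continuous.tendsto _).comp hμ
  -- convergence of the gradients
  have hgrad : Tendsto (fun n => (Fn n).gradL2 Q) atTop (𝓝 (F.gradL2 Q)) := by
    have hbound := fun i => hbox.exists_bound_of_continuousOn (F.continuous_partial i).continuousOn
    choose K hK using hbound
    obtain ⟨B, hB⟩ : ∃ B, B = ∑ i, K i * C i := ⟨_, rfl⟩
    have hBn : ∀ n μ x, |(Fn n).grad μ x| ≤ B := by
      intro n μ x
      rw [hB]
      refine (Finset.abs_sum_le_sum_abs _ _).trans (Finset.sum_le_sum fun i _ => ?_)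
      rw [abs_mul]
      exact mul_le_mul (hK i _ (hmemn n μ)) (hψC i n x) (abs_nonneg _)
        ((norm_nonneg _).trans (hK i _ (hmemn n μ)))
    have hBF : ∀ μ x, |F.grad μ x| ≤ B := by
      intro μ x
      rw [hB]
      refine (Finset.abs_sum_le_sum_abs _ _).trans (Finset.sum_le_sum fun i _ => ?_)
      rw [abs_mul]
      exact mul_le_mul (hK i _ (hmemF μ)) (hC i x) (abs_nonneg _)
        ((norm_nonneg _).trans (hK i _ (hmemF μ)))
    have hcb : ∀ G : Cyl S, (∀ μ x, |G.grad μ x| ≤ B) → ∀ μ x, |G.cgrad μ x| ≤ B + B := by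
      intro G hG μ x
      refine (abs_sub _ _).trans (add_le_add (hG μ x) ?_)
      simpa using norm_integral_le_of_norm_le_const (μ := (μ : Measure S)) (f := G.grad μ)
        (Eventually.of_forall (hG μ))
    have hpt : ∀ᵐ p ∂pointLaw Q, p.2 ∉ N := by
      refine (measure_eq_zero_iff_ae_notMem (s := Prod.snd ⁻¹' N)).1 ?_
      rw [pointLaw, Measure.compProd_apply (measurable_snd hNm), lintegral_eq_zero_iff
          (Kernel.measurable_kernel_prodMk_left (measurable_snd hNm))]
      exact hQN
    have hpt2 : ∀ᵐ p ∂pointLaw Q, Tendsto (fun n => (Fn n).pairing p.1) atTop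
        (𝓝 (F.pairing p.1)) ∧ (p.1 : Measure S) N = 0 := by
      refine ae_of_ae_map (μ := pointLaw Q) (f := Prod.fst) (p := fun μ : ProbabilityMeasure S =>
        Tendsto (fun n => (Fn n).pairing μ) atTop (𝓝 (F.pairing μ)) ∧ (μ : Measure S) N = 0)
        measurable_fst.aemeasurable ?_
      rw [← Measure.fst, pointLaw, Measure.fst_compProd]
      exact hpair.and hQN
    refine (tendsto_toLp_of_bounded (C := B + B) (fun n => (Fn n).memLp_cgrad Q)
      (F.memLp_cgrad Q) (fun n p => hcb _ (hBn n) p.1 p.2) (fun p => hcb _ hBF p.1 p.2) ?_).const_smul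
        ((√2)⁻¹)
    filter_upwards [hpt, hpt2] with p hp1 hp2
    have hg : ∀ x ∉ N, Tendsto (fun n => (Fn n).grad p.1 x) atTop (𝓝 (F.grad p.1 x)) := by
      intro x hx
      change Tendsto (fun n => ∑ i : Fin F.d, fderiv ℝ F.f ((Fn n).pairing p.1) (Pi.single i 1) *
        ψ i n x) atTop (𝓝 (∑ i : Fin F.d, fderiv ℝ F.f (F.pairing p.1) (Pi.single i 1) * F.φ i x))
      refine tendsto_finsetSum _ fun i _ => Tendsto.mul ?_ (hconv x hx i)
      exact ((F.continuous_partial i).tendsto _).comp hp2.1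
    refine (hg p.2 hp1).sub (tendsto_integral_of_dominated_convergence (fun _ => B)
      (fun n => ((Fn n).integrable_grad p.1 _).aestronglyMeasurable) (integrable_const _)
      (fun n => Eventually.of_forall (hBn n p.1)) ?_)
    filter_upwards [measure_eq_zero_iff_ae_notMem.1 hp2.2] with x hx using hg x hx
  exact ((WithLp.prod_continuous_toLp 2 _ _).tendsto _).comp (hJ.prodMk_nhds hgrad)

/-- The functions of finitely many cells are dense in the cylinder functions for the graph norm. -/
theorem DyadicPartition.mem_closure_graph {θ : ℝ} (hθ : -(1 / 2) < θ) {ν : ProbabilityMeasure S}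
    (D : DyadicPartition (ν : Measure S)) (hD : D.Generates) (F : Cyl S) :
    WithLp.toLp 2 (F.toL2 (dirichletLaw (1 / 2) θ ν), F.gradL2 (dirichletLaw (1 / 2) θ ν)) ∈
      (⨆ k, D.graph (dirichletLaw (1 / 2) θ ν) k).topologicalClosure := by
  choose C hC using F.φ_bdd
  have hstep := fun i => D.exists_isStep_tendsto hD (F.φ_meas i) (hC i)
  choose ψ hψm hψC hψs hψlim using hstep
  -- One measurable null set outside which all the finitely many test functions converge.
  obtain ⟨N, hNsub, hNm, hN0⟩ := exists_measurable_superset_of_null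
    ((measure_eq_zero_iff_ae_notMem (s := {x | ¬ ∀ i, Tendsto (fun n => ψ i n x) atTop
      (𝓝 (F.φ i x))})).2 ((ae_all_iff.2 hψlim).mono fun x hx => not_not.2 hx))
  have hconv : ∀ x ∉ N, ∀ i, Tendsto (fun n => ψ i n x) atTop (𝓝 (F.φ i x)) := fun x hx =>
    by_contra fun h => hx (hNsub h)
  refine mem_closure_of_tendsto (F.tendsto_graph _ hC hψm hψC hNm
    (ae_dirichletLaw_null hθ ν hNm hN0) hconv rfl) (Eventually.of_forall fun n => ?_)
  exact (le_iSup (D.graph _) n) (D.mem_graph_of_isStep _ _ fun i => hψs i n)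

end

end TwoParamDirichlet

theorem corollary3p3 {S : Type*} [MetricSpace S] [LocallyCompactSpace S]
    [TopologicalSpace.SeparableSpace S] [MeasurableSpace S] [BorelSpace S]
    (θ : ℝ) (hθ : -(1 / 2) < θ)
    (ν₀ : ProbabilityMeasure S) (hν₀ : ∀ x, (ν₀ : Measure S) {x} = 0)
    (D : DyadicPartition (ν₀ : Measure S)) (hD : D.Generates) :
    ∃ (q : ℕ → SymForm (Lp ℝ 2 (dirichletLaw (1 / 2) θ ν₀)))
      (Ξ : SymForm (Lp ℝ 2 (dirichletLaw (1 / 2) θ ν₀))),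
      (∀ k, IsClosureOf (q k) (Cyl.toL2 (dirichletLaw (1 / 2) θ ν₀))
        (gradForm (dirichletLaw (1 / 2) θ ν₀)) (D.cylSet k)) ∧
      IsRelaxation Ξ (Cyl.toL2 (dirichletLaw (1 / 2) θ ν₀))
        (gradForm (dirichletLaw (1 / 2) θ ν₀)) Set.univ ∧
      MoscoTendsto q Ξ :=
  exists_closure_relaxation_mosco (Cyl.toL2 (dirichletLaw (1 / 2) θ ν₀))
    (Cyl.gradL2 · (dirichletLaw (1 / 2) θ ν₀)) (gradForm (dirichletLaw (1 / 2) θ ν₀))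
    (Cyl.gradForm_eq_inner _) D.cylSet (D.graph _) (fun _ _ => D.mem_graph _)
    (D.monotone_graph _) (D.mem_closure_graph hθ hD)
    (gradL2_closable hθ ν₀ (dirichletLaw_eq hθ ν₀))
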